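/- An oriented graph is a finite digraph without loops and without digons (pairs of opposite arcs); its order is its number of vertices. For a set $X$ of vertices of an oriented graph $D$, the inversion of $X$ reverses all arcs of $D$ with both endvertices in $X$ and keeps all other arcs. For a positive integer $p$, $D$ is called $(=p)$-invertible if it can be made acyclic by a finite (possibly empty) sequence of inversions of vertex sets of size exactly $p$. Theorem. There is a polynomial-time algorithm that, given a positive integer $p$ and an oriented graph $D$ of order distinct from $p+1$, decides whether $D$ is $(=p)$-invertible. That is, there are a Turing machine and a polynomial $q$ such that on every input $(p, D)$ with $|V(D)| \neq p+1$, where $p \ge 1$ is written in binary and $D$ is given by its adjacency matrix, the machine halts after at most $q(\ell)$ steps, where $\ell$ is the length of the input string, and outputs whether $D$ is $(=p)$-invertible. -/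

import Mathlib

/-- An oriented graph on the vertex set `V`: a digraph without digons (and hence without loops). -/
structure OrientedGraph (V : Type*) extends Digraph V where
  /-- At most one of the arcs `uv` and `vu` is present. -/
  asymm : ∀ u v, Adj u v → ¬ Adj v u

namespace OrientedGraph

/-- The inversion of `X` in `D`: all arcs with both endvertices in `X` are reversed, and all other
arcs are kept. -/
def invert {V : Type*} (D : OrientedGraph V) (X : Finset V) : OrientedGraph V where
  Adj u v := (u ∈ X ∧ v ∈ X ∧ D.Adj v u) ∨ (¬ (u ∈ X ∧ v ∈ X) ∧ D.Adj u v)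
  asymm u v := by
    have h₁ := D.asymm u v
    have h₂ := D.asymm v u
    tauto

/-- The oriented graph obtained from `D` by inverting the members of a family, one after another. -/
def invertFamily {V : Type*} (D : OrientedGraph V) (F : List (Finset V)) : OrientedGraph V :=
  F.foldl invert D

/-- `D` is acyclic: there is no directed closed walk of positive length (equivalently, there is no
directed cycle). -/
def IsAcyclic {V : Type*} (D : OrientedGraph V) : Prop :=
  ∀ v, ¬ Relation.TransGen D.Adj v v

/-- `D` is `(=p)`-invertible: it can be made acyclic by inversions of sets of size exactly `p`
(any finite number of them, possibly none). -/
def IsEqInvertible {V : Type*} (p : ℕ) (D : OrientedGraph V) : Prop :=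
  ∃ F : List (Finset V), (∀ X ∈ F, X.card = p) ∧ (D.invertFamily F).IsAcyclic

end OrientedGraph

/-- An instance of the decision problem: a positive integer `p` and a finite oriented graph
(on `0, …, n - 1`) whose order `n` is distinct from `p + 1`. -/
structure EqInversionInstance where
  /-- The prescribed size of the inverted sets. -/
  p : ℕ
  /-- The order of the oriented graph. -/
  n : ℕ
  /-- The oriented graph. -/
  graph : OrientedGraph (Fin n)
  p_pos : 0 < p
  order_ne : n ≠ p + 1

namespace EqInversionInstance

open Computability in
open scoped Classical in
/-- The row of the vertex `u` in the adjacency matrix of `D`, as a string of bits. -/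
noncomputable def encodeRow {n : ℕ} (D : OrientedGraph (Fin n)) (u : Fin n) : List Γ' :=
  List.ofFn fun v => Γ'.bit (decide (D.Adj u v))

open Computability in
/-- The input string of an instance, over the standard Turing machine alphabet: the binary
expansion of `p`, then the rows of the adjacency matrix, each part being ended by a comma. -/
noncomputable def encode (I : EqInversionInstance) : List Γ' :=
  (encodeNat I.p).map Γ'.bit ++ Γ'.comma ::
    (List.finRange I.n).flatMap fun u => encodeRow I.graph u ++ [Γ'.comma]

open scoped Classical in
/-- The correct answer: whether the oriented graph of the instance is `(=p)`-invertible. -/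
noncomputable def answer (I : EqInversionInstance) : Bool :=
  decide (I.graph.IsEqInvertible I.p)

end EqInversionInstance

/-! Over the field with two elements, a sequence of inversions reverses exactly the arcs in the sum
of the complete graphs on the inverted sets. So D is (=p)-invertible iff reversing some S in the
span of the p-cliques makes D acyclic (`isEqInvertible_iff`). Let n be the order. If p = 1 or p ≥ n,
an inversion changes nothing or reverses everything, and only acyclicity has to be tested.

Let p ≥ 2 and n ≥ p + 2. Four cliques sharing p - 2 vertices add up to a 4-cycle, so the span
contains all 4-cycles. For even p it contains the sum of any two edges. Given any linear order, the
set of arcs to be reversed is then in the span, possibly after adding the edge between the first two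
vertices, which amounts to swapping them; hence D is always invertible. For odd p all elements of
the span have even degrees. Conversely every even graph is in the span up to one triangle, which is
absorbed by reversing the order of the first three vertices. So the question becomes whether
flipping some even graph S makes D acyclic (`isEqInvertible_iff_of_odd`).

Fix an order. Then S is forced on pairs joined by an arc and free on the other pairs, so it exists
iff the forced degrees have even sum over each component of the complement, a T-join condition
(`exists_even_iff`). Modulo 2 this sum is the sum of the positions in the component plus the
quantity `parity`, which does not depend on the order (`sum_mismatch`). Hence only the set of
vertices at odd positions matters: a set of ⌊n/2⌋ vertices must have a prescribed parity in each
component. It exists iff neither the set nor its complement is required to be odd on too many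
components (`exists_card_parity_iff`), which is easy to count.

For the machine model, these tests are written as queries in a small language whose constructs cost
polynomial time each. Queries are compiled to structured stack programs, and these to Turing
machines. As p is binary, it is compared with n by repeated halving of n. -/

/-! ### A structured programming language on finitely many stacks -/

namespace StackProg

open Turing Function

/-- Structured programs acting on stacks indexed by `K` with symbols in `A`. -/
inductive Cmd (K A : Type) : Type
  | skip : Cmd K A
  | push (k : K) (a : A) : Cmd K A
  /-- Pop the stack `k` and branch on the symbol found. -/
  | pop (k : K) (f : Option A → Cmd K A) : Cmd K A
  | seq (c d : Cmd K A) : Cmd K A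
  /-- Pop the stack `k` repeatedly and run `f a` on the symbols `a` found, until the stack is empty
  or `g a` fails. -/
  | loop (k : K) (g : A → Bool) (f : A → Cmd K A) : Cmd K A

variable {K A : Type}

/-- The program labels used by the translation of a command into a machine. -/
def Cmd.Label : Cmd K A → Type
  | .skip => Unit
  | .push _ _ => Unit
  | .pop _ f => Option (Σ o, (f o).Label)
  | .seq c d => c.Label ⊕ d.Label
  | .loop _ _ f => Option (Σ a, (f a).Label)

/-- `FinTM2` requires finitely many labels. A command branches only over the symbols of `A` (or
their absence), so its tree of labels is finite although `pop` and `loop` take functions. -/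
theorem Cmd.finite_label [Finite A] (c : Cmd K A) : Finite c.Label := by
  induction c with
  | skip => exact inferInstanceAs (Finite Unit)
  | push => exact inferInstanceAs (Finite Unit)
  | pop k f ih => exact inferInstanceAs (Finite (Option (Σ o, (f o).Label)))
  | seq c d ihc ihd => exact inferInstanceAs (Finite (c.Label ⊕ d.Label))
  | loop k g f ih => exact inferInstanceAs (Finite (Option (Σ a, (f a).Label)))

/-- The label at which the execution of a command starts. -/
def Cmd.entry : (c : Cmd K A) → c.Label
  | .skip => ()
  | .push _ _ => ()
  | .pop _ _ => none
  | .seq c _ => Sum.inl c.entry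
  | .loop _ _ _ => none

/-- The stack alphabets of the machine: there is one additional stack for the output. -/
def Alphabet (K A : Type) : Option K → Type
  | none => Bool
  | some _ => A

/-- The machine statement at a label of a command, where `ι` embeds the labels of the command into
those of the machine and `exit` is the label to continue with. -/
def Cmd.code {Λ : Type} : (c : Cmd K A) → (c.Label → Λ) → Λ → c.Label →
    TM2.Stmt (Alphabet K A) Λ (Option A)
  | .skip, _, exit, _ => .goto fun _ => exit
  | .push k a, _, exit, _ => .push (some k) (fun _ => a) (.goto fun _ => exit)
  | .pop k f, ι, _, none =>
      .pop (some k) (fun _ o => o) (.goto fun o => ι (some ⟨o, (f o).entry⟩))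
  | .pop _ f, ι, exit, some ⟨o, l⟩ => (f o).code (fun l => ι (some ⟨o, l⟩)) exit l
  | .seq c d, ι, _, .inl l => c.code (fun l => ι (.inl l)) (ι (.inr d.entry)) l
  | .seq _ d, ι, exit, .inr l => d.code (fun l => ι (.inr l)) exit l
  | .loop k g f, ι, exit, none =>
      .pop (some k) (fun _ o => o) (.goto fun o => match o with
        | none => exit
        | some a => if g a then ι (some ⟨a, (f a).entry⟩) else exit)
  | .loop _ _ f, ι, _, some ⟨a, l⟩ => (f a).code (fun l => ι (some ⟨a, l⟩)) (ι none) l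

variable [DecidableEq K]

/-- `Runs c s s' t`: the command `c` turns the stacks `s` into `s'` in exactly `t` steps. -/
inductive Runs : Cmd K A → (K → List A) → (K → List A) → ℕ → Prop
  | skip (s) : Runs .skip s s 1
  | push (s k a) : Runs (.push k a) s (update s k (a :: s k)) 1
  | pop {s k f s' t} (h : Runs (f (s k).head?) (update s k (s k).tail) s' t) :
      Runs (.pop k f) s s' (t + 1)
  | seq {c d s s₁ s₂ t₁ t₂} (h₁ : Runs c s s₁ t₁) (h₂ : Runs d s₁ s₂ t₂) :
      Runs (.seq c d) s s₂ (t₁ + t₂)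
  | loop_exit {k g f s} (h : ∀ a, (s k).head? = some a → g a = false) :
      Runs (.loop k g f) s (update s k (s k).tail) 1
  | loop_step {k g f s a l s₁ s₂ t₁ t₂} (h : s k = a :: l) (hg : g a = true)
      (h₁ : Runs (f a) (update s k l) s₁ t₁) (h₂ : Runs (.loop k g f) s₁ s₂ t₂) :
      Runs (.loop k g f) s s₂ (t₁ + t₂ + 1)

/-- The stacks of the machine, with an empty output stack. -/
def extend (s : K → List A) : ∀ k, List (Alphabet K A k)
  | none => []
  | some k => s k

theorem update_extend (s : K → List A) (k : K) (l : List A) :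
    (update (extend s) (some k) l : ∀ k, List (Alphabet K A k)) = extend (update s k l) := by
  funext k'
  cases k' with
  | none => exact update_of_ne (by simp) _ _
  | some k' =>
    by_cases h : k' = k
    · subst h
      refine (update_self (β := fun k => List (Alphabet K A k)) (some k') l (extend s)).trans ?_
      exact (update_self k' l s).symm
    · refine (update_of_ne (β := fun k => List (Alphabet K A k)) (by simpa using h) _ _).trans ?_
      exact (update_of_ne h l s).symm

/-- The machine `m` gets from the first configuration to the second one in `t` steps. -/
def Reaches {Λ : Type} (m : Λ → TM2.Stmt (Alphabet K A) Λ (Option A)) (t : ℕ)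
    (x y : TM2.Cfg (Alphabet K A) Λ (Option A)) : Prop :=
  (flip bind (TM2.step m))^[t] (some x) = some y

theorem Reaches.trans {Λ : Type} {m : Λ → TM2.Stmt (Alphabet K A) Λ (Option A)} {t t' : ℕ}
    {x y z} (h : Reaches m t x y) (h' : Reaches m t' y z) : Reaches m (t + t') x z := by
  unfold Reaches at *
  rw [Nat.add_comm, iterate_add_apply, h, h']

theorem Reaches.single {Λ : Type} {m : Λ → TM2.Stmt (Alphabet K A) Λ (Option A)} {l v S y q}
    (hq : m l = q) (h : TM2.stepAux q v S = y) : Reaches m 1 ⟨some l, v, S⟩ y := by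
  subst hq
  exact congrArg some h

/-- Arbitrary `ι` and `exit` make the statement compositional: a subcommand is run with its labels
embedded further and with its own continuation. The register content `v` is arbitrary because it is
read only right after a pop has set it. -/
theorem Runs.reaches {c : Cmd K A} {s s' : K → List A} {t : ℕ} (h : Runs c s s' t) {Λ : Type}
    (m : Λ → TM2.Stmt (Alphabet K A) Λ (Option A)) (ι : c.Label → Λ) (exit : Λ)
    (hm : ∀ l, m (ι l) = c.code ι exit l) (v : Option A) :
    ∃ v', Reaches m t ⟨some (ι c.entry), v, extend s⟩ ⟨some exit, v', extend s'⟩ := by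
  induction h generalizing Λ v with
  | skip s => exact ⟨v, Reaches.single (hm _) rfl⟩
  | push s k a =>
    refine ⟨v, Reaches.single (hm _) ?_⟩
    rw [← update_extend]
    rfl
  | @pop s k f s' t h ih =>
    obtain ⟨v', hv⟩ := ih m (fun l => ι (some ⟨_, l⟩)) exit (fun l => hm _) (s k).head?
    refine ⟨v', ?_⟩
    rw [Nat.add_comm]
    refine Reaches.trans (Reaches.single (hm _) ?_) hv
    rw [← update_extend]
    rfl
  | @seq c d s s₁ s₂ t₁ t₂ h₁ h₂ ih₁ ih₂ =>
    obtain ⟨v₁, hv₁⟩ := ih₁ m (fun l => ι (.inl l)) (ι (.inr d.entry)) (fun l => hm _) v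
    obtain ⟨v₂, hv₂⟩ := ih₂ m (fun l => ι (.inr l)) exit (fun l => hm _) v₁
    exact ⟨v₂, hv₁.trans hv₂⟩
  | @loop_exit k g f s h =>
    refine ⟨(s k).head?, Reaches.single (hm _) ?_⟩
    rw [← update_extend]
    have : (match (s k).head? with
        | none => exit
        | some a => if g a then ι (some ⟨a, (f a).entry⟩) else exit) = exit := by
      rcases hk : (s k).head? with _ | a
      · rfl
      · simp [h a hk]
    exact congrArg (fun l => (⟨some l, _, _⟩ : TM2.Cfg (Alphabet K A) Λ (Option A))) this
  | @loop_step k g f s a l s₁ s₂ t₁ t₂ h hg h₁ h₂ ih₁ ih₂ =>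
    obtain ⟨v₁, hv₁⟩ := ih₁ m (fun l => ι (some ⟨a, l⟩)) (ι none) (fun l => hm _) (s k).head?
    obtain ⟨v₂, hv₂⟩ := ih₂ m ι exit hm v₁
    refine ⟨v₂, ?_⟩
    rw [Nat.add_comm]
    refine Reaches.trans (Reaches.single (hm _) ?_) (hv₁.trans hv₂)
    have e : l = (s k).tail := by rw [h]; rfl
    rw [e, ← update_extend]
    have : (match (s k).head? with
        | none => exit
        | some a => if g a then ι (some ⟨a, (f a).entry⟩) else exit) =
          ι (some ⟨a, (f a).entry⟩) := by
      simp [h, hg]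
    exact congrArg (fun l => (⟨some l, _, _⟩ : TM2.Cfg (Alphabet K A) Λ (Option A))) this

/-- The machine running a command with input stack `i`, and then outputting the Boolean read off
the top of the stack `r`. -/
noncomputable def machine [Fintype K] [Fintype A] (c : Cmd K A) (i r : K) (out : A → Bool) :
    FinTM2 :=
  haveI : Fintype c.Label := @Fintype.ofFinite _ c.finite_label
  { K := Option K
    k₀ := some i
    k₁ := none
    Γ := Alphabet K A
    Λ := Option c.Label
    main := some c.entry
    σ := Option A
    initialState := none
    Γk₀Fin := inferInstanceAs (Fintype A)
    m := fun l => match l with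
      | some l => c.code some none l
      | none => .pop (some r) (fun _ o => o)
          (.push none (fun o => (o.map out).getD false) (.load (fun _ => none) .halt)) }

/-- A function computed by a command in polynomial time is computed by a machine in polynomial
time. -/
theorem exists_machine [Fintype K] [Fintype A] (c : Cmd K A) (i r : K) (out : A → Bool)
    {α : Type} (ea : α → List A) (f : α → Bool) (q : Polynomial ℕ)
    (h : ∀ a, ∃ t ≤ q.eval (ea a).length, ∃ x, out x = f a ∧
      Runs c (update (fun _ => []) i (ea a)) (update (fun _ => []) r [x]) t) :
    ∃ M : TM2ComputableInPolyTime ea Computability.encodeBool f, ∀ k, Finite (M.tm.Γ k) := by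
  choose t ht x hx hr using h
  refine ⟨⟨⟨machine c i r out, Equiv.refl A, Equiv.refl Bool⟩, q + 1, fun a => ?_⟩, fun k => ?_⟩
  · have h₁ : ∃ v', Reaches (machine c i r out).m (t a)
        ⟨some (some c.entry), none, extend _⟩ ⟨some none, v', extend _⟩ :=
      (hr a).reaches (machine c i r out).m some none (fun l => rfl) none
    -- The extra step is the final label: it copies the answer to the output stack and resets the
    -- register, since a halting configuration contains the initial state.
    have h₂ : Reaches (machine c i r out).m (t a + 1)
        (initList (machine c i r out) (ea a)) (haltList (machine c i r out) [f a]) := by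
      obtain ⟨v', hv⟩ := h₁
      have e₁ : initList (machine c i r out) (ea a) =
          ⟨some (some c.entry), none, extend (update (fun _ => []) i (ea a))⟩ := by
        unfold initList
        congr 1
        funext k
        by_cases hk : k = some i
        · subst hk
          refine (dif_pos rfl).trans ?_
          exact (update_self i (ea a) fun _ => []).symm
        · refine (dif_neg hk).trans ?_
          cases k with
          | none => rfl
          | some k => exact (update_of_ne (fun h => hk (congrArg some h)) (ea a) fun _ => []).symm
      rw [e₁]
      refine hv.trans (Reaches.single rfl ?_)
      have e₂ : haltList (machine c i r out) [f a] =
          ⟨none, none, update (extend fun _ => []) none [f a]⟩ := by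
        unfold haltList
        congr 1
        funext k
        cases k with
        | none => rfl
        | some k => rfl
      rw [e₂]
      refine congrArg (fun S => (⟨none, none, S⟩ : TM2.Cfg (Alphabet K A) _ (Option A))) ?_
      have e₃ : (update (extend (update (fun _ => []) r [x a])) (some r)
          (update (fun _ => []) r [x a] r).tail : ∀ k, List (Alphabet K A k)) =
            extend fun _ => [] := by
        rw [update_extend]
        congr 1
        funext k
        by_cases hk : k = r
        · subst hk; simp
        · simp [hk]
      have e₄ : (((update (fun _ => []) r [x a] r).head?.map out).getD false : Bool) = f a := by
        simp [hx]
      rw [← e₃, ← e₄]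
      rfl
    refine ⟨⟨t a + 1, ?_⟩, ?_⟩
    · have : List.map (Equiv.refl A).invFun (ea a) = ea a := List.map_id _
      rw [← this] at h₂
      exact h₂
    · simp only [Polynomial.eval_add, Polynomial.eval_one]
      exact Nat.add_le_add_right (ht a) 1
  · cases k with
    | none => exact inferInstanceAs (Finite Bool)
    | some k => exact inferInstanceAs (Finite A)

end StackProg

/-! ### Stack routines and their running times -/

namespace StackProg

open Turing Function Computability

section Macros

variable {K A : Type} [DecidableEq K]

/-- The command `c` turns the stacks `s` into `s'` in at most `T` steps. -/
def RunsIn (c : Cmd K A) (s s' : K → List A) (T : ℕ) : Prop :=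
  ∃ t ≤ T, Runs c s s' t

theorem RunsIn.mono {c : Cmd K A} {s s' : K → List A} {T T' : ℕ} (h : RunsIn c s s' T)
    (hT : T ≤ T') : RunsIn c s s' T' :=
  let ⟨t, ht, hr⟩ := h
  ⟨t, ht.trans hT, hr⟩

theorem RunsIn.cast {c : Cmd K A} {s s₁ s₂ : K → List A} {T T' : ℕ} (h : RunsIn c s s₁ T)
    (hs : s₁ = s₂) (hT : T ≤ T') : RunsIn c s s₂ T' := hs ▸ h.mono hT

theorem RunsIn.skip (s : K → List A) : RunsIn .skip s s 1 := ⟨1, le_rfl, .skip s⟩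

theorem RunsIn.push (s : K → List A) (k : K) (a : A) :
    RunsIn (.push k a) s (update s k (a :: s k)) 1 := ⟨1, le_rfl, .push s k a⟩

theorem RunsIn.seq {c d : Cmd K A} {s s₁ s₂ : K → List A} {T₁ T₂ : ℕ} (h₁ : RunsIn c s s₁ T₁)
    (h₂ : RunsIn d s₁ s₂ T₂) : RunsIn (.seq c d) s s₂ (T₁ + T₂) :=
  let ⟨t₁, ht₁, hr₁⟩ := h₁
  let ⟨t₂, ht₂, hr₂⟩ := h₂
  ⟨t₁ + t₂, add_le_add ht₁ ht₂, hr₁.seq hr₂⟩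

theorem RunsIn.pop {k : K} {f : Option A → Cmd K A} {s s' : K → List A} {o : Option A}
    {l : List A} {T : ℕ} (ho : (s k).head? = o) (hl : (s k).tail = l)
    (h : RunsIn (f o) (update s k l) s' T) : RunsIn (.pop k f) s s' (T + 1) := by
  subst ho hl
  obtain ⟨t, ht, hr⟩ := h
  exact ⟨t + 1, Nat.add_le_add_right ht 1, hr.pop⟩

theorem RunsIn.loop_empty {k : K} {g : A → Bool} {f : A → Cmd K A} {s : K → List A}
    (h : s k = []) : RunsIn (.loop k g f) s s 1 := by
  refine ⟨1, le_rfl, ?_⟩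
  have := Runs.loop_exit (k := k) (g := g) (f := f) (s := s) (by simp [h])
  rwa [h, List.tail_nil, ← h, update_eq_self] at this

/-- The symbol that fails the test is consumed; in `parse` this removes the comma after the binary
number. -/
theorem RunsIn.loop_exit {k : K} {g : A → Bool} {f : A → Cmd K A} {s : K → List A} {a : A}
    {l : List A} (h : s k = a :: l) (hg : g a = false) :
    RunsIn (.loop k g f) s (update s k l) 1 := by
  refine ⟨1, le_rfl, ?_⟩
  have := Runs.loop_exit (k := k) (g := g) (f := f) (s := s) (by simp [h, hg])
  rwa [h, List.tail_cons] at this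

theorem RunsIn.loop_step {k : K} {g : A → Bool} {f : A → Cmd K A} {s s₁ s₂ : K → List A} {a : A}
    {l : List A} {T₁ T₂ : ℕ} (h : s k = a :: l) (hg : g a = true)
    (h₁ : RunsIn (f a) (update s k l) s₁ T₁) (h₂ : RunsIn (.loop k g f) s₁ s₂ T₂) :
    RunsIn (.loop k g f) s s₂ (T₁ + T₂ + 1) :=
  let ⟨t₁, ht₁, hr₁⟩ := h₁
  let ⟨t₂, ht₂, hr₂⟩ := h₂
  ⟨t₁ + t₂ + 1, by omega, hr₁.loop_step h hg hr₂⟩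

/-- Empty the stack `k`. -/
def clear (k : K) : Cmd K A := .loop k (fun _ => true) fun _ => .skip

/-- Each round costs one step for the pop and one for the body, and the last, failing pop costs one
more. The later bounds are counted in the same way. -/
theorem runsIn_clear (k : K) (s : K → List A) :
    RunsIn (clear k) s (update s k []) (2 * (s k).length + 1) := by
  generalize hl : s k = l
  induction l generalizing s with
  | nil =>
    rw [← hl, update_eq_self]
    exact (RunsIn.loop_empty hl).mono (by simp)
  | cons a l ih =>
    have := ih (update s k l) (by simp)
    rw [update_idem] at this
    exact (RunsIn.loop_step hl rfl (RunsIn.skip _) this).mono (by simp; omega)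

/-- Move the content of the stack `k` to the stack `k'`, in reverse order. -/
def move (k k' : K) : Cmd K A := .loop k (fun _ => true) fun a => .push k' a

theorem runsIn_move {k k' : K} (hk : k ≠ k') (s : K → List A) :
    RunsIn (move k k') s (update (update s k []) k' ((s k).reverse ++ s k'))
      (2 * (s k).length + 1) := by
  generalize hl : s k = l
  induction l generalizing s with
  | nil =>
    refine (RunsIn.loop_empty hl).cast ?_ (by simp)
    funext x
    simp only [update_apply]
    split_ifs <;> simp_all
  | cons a l ih =>
    have := ih (update (update s k l) k' (a :: s k')) (by simp [hk])
    refine (RunsIn.loop_step (s₁ := update (update s k l) k' (a :: s k')) (T₁ := 1) hl rfl ?_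
      this).cast ?_ (by simp; omega)
    · have := RunsIn.push (update s k l) k' a
      simpa [hk.symm] using this
    · funext x
      simp only [update_apply]
      split_ifs <;> simp_all

/-- Append a reversed copy of the stack `k` to the stack `k'`, using the stack `t`. -/
def copy (k k' t : K) : Cmd K A :=
  .seq (.loop k (fun _ => true) fun a => .seq (.push t a) (.push k' a)) (move t k)

theorem runsIn_copy {k k' t : K} (h₁ : k ≠ k') (h₂ : k ≠ t) (h₃ : k' ≠ t) (s : K → List A)
    (ht : s t = []) :
    RunsIn (copy k k' t) s (update s k' ((s k).reverse ++ s k')) (5 * (s k).length + 2) := by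
  have key : ∀ (l : List A) (s : K → List A), s k = l →
      RunsIn (.loop k (fun _ => true) fun a => .seq (.push t a) (.push k' a)) s
        (update (update (update s k []) t (l.reverse ++ s t)) k' (l.reverse ++ s k'))
        (3 * l.length + 1) := by
    intro l
    induction l with
    | nil =>
      intro s hl
      refine (RunsIn.loop_empty hl).cast ?_ (by simp)
      funext x
      simp only [update_apply]
      split_ifs <;> simp_all
    | cons a l ih =>
      intro s hl
      have := ih (update (update (update s k l) t (a :: s t)) k' (a :: s k')) (by simp [h₁, h₂])
      refine (RunsIn.loop_step (s₁ := update (update (update s k l) t (a :: s t)) k' (a :: s k'))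
        (T₁ := 2) hl rfl ?_ this).cast ?_ (by simp; omega)
      · refine ((RunsIn.push _ _ _).seq (RunsIn.push _ _ _)).cast ?_ le_rfl
        simp [h₂.symm, h₁.symm, h₃]
      · funext x
        simp only [update_apply]
        split_ifs <;> simp_all
  refine ((key _ s rfl).seq (runsIn_move h₂.symm _)).cast ?_ ?_
  · funext x
    simp only [update_apply]
    split_ifs <;> simp_all
  · simp [h₃.symm, ht]; omega

/-- Move as many symbols from the stack `m` to the stack `m'` as there are symbols on the stack `i`,
moving the latter to the stack `t`. -/
def shift (i t m m' : K) : Cmd K A :=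
  .loop i (fun _ => true) fun a => .seq (.push t a) (.pop m fun o => match o with
    | none => .skip
    | some b => .push m' b)

theorem runsIn_shift {i t m m' : K} (h₁ : i ≠ t) (h₂ : i ≠ m) (h₃ : i ≠ m') (h₄ : t ≠ m)
    (h₅ : t ≠ m') (h₆ : m ≠ m') (s : K → List A) :
    RunsIn (shift i t m m') s
      (update (update (update (update s i []) t ((s i).reverse ++ s t)) m
        ((s m).drop (s i).length)) m' (((s m).take (s i).length).reverse ++ s m'))
      (4 * (s i).length + 1) := by
  generalize hl : s i = l
  induction l generalizing s with
  | nil =>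
    refine (RunsIn.loop_empty hl).cast ?_ (by simp)
    funext x
    simp only [update_apply]
    split_ifs <;> simp_all
  | cons a l ih =>
    have := ih (update (update (update (update s i l) t (a :: s t)) m ((s m).drop 1)) m'
      (((s m).take 1).reverse ++ s m')) (by simp [h₁, h₂, h₃])
    refine (RunsIn.loop_step (s₁ := update (update (update (update s i l) t (a :: s t)) m
      ((s m).drop 1)) m' (((s m).take 1).reverse ++ s m')) (T₁ := 3) hl rfl ?_
        this).cast ?_ (by simp; omega)
    · refine (RunsIn.push _ _ _).seq (T₂ := 2) ?_
      have e : update (update s i l) t (a :: update s i l t) m = s m := by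
        simp [h₂.symm, h₄.symm]
      refine RunsIn.pop (T := 1) rfl rfl ?_
      rw [e]
      rcases hm : s m with _ | ⟨b, r⟩
      · refine (RunsIn.skip _).cast ?_ le_rfl
        funext x
        simp only [update_apply]
        split_ifs <;> simp_all
      · refine (RunsIn.push _ _ _).cast ?_ le_rfl
        funext x
        simp only [update_apply]
        split_ifs <;> simp_all
    · rcases hm : s m with _ | ⟨b, r⟩
      · funext x
        simp only [update_apply]
        split_ifs <;> simp_all
      · funext x
        simp only [update_apply]
        split_ifs <;> simp_all

end Macros

/-- The stacks: the input, the order, the adjacency matrix, results, scratch stacks, and four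
stacks for each of the bound variables named by `B`. -/
inductive Stk (B : Type) : Type
  | inp | size | mat | res | tmp₁ | tmp₂ | tmp₃
  | idx (b : B) | rem (b : B) | vec (b : B) | buf (b : B)
  deriving DecidableEq, Fintype

/-- The symbol used to represent numbers in unary. -/
abbrev one : Γ' := Γ'.bit true

/-- Whether the symbol is the bit `true`. -/
def isOne (o : Option Γ') : Bool := o = some one

@[simp] theorem isOne_bit (b : Bool) : isOne (some (Γ'.bit b)) = b := by
  cases b <;> simp [isOne, one]

@[simp] theorem isOne_none : isOne none = false := rfl

variable {B : Type} [DecidableEq B]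

open Stk

/-- Push on `res` a bit depending on the symbol of the stack `m` whose position is the length of the
stack `i`, and return the symbols on `tmp₃` to `m`. -/
def lookup (i m : Stk B) (f : Option Γ' → Bool) : Cmd (Stk B) Γ' :=
  .seq (shift i tmp₁ m tmp₃) (.seq (move tmp₁ i) (.pop m fun o =>
    .seq (match o with
      | none => .skip
      | some a => .push m a)
    (.seq (move tmp₃ m) (.push res (.bit (f o))))))

/-- The stack `tmp₃` need not be empty: for a matrix entry, `skipRows` has already parked whole rows
there, and the same final move restores them. -/
theorem runsIn_lookup {i m : Stk B} (h₁ : i ≠ tmp₁) (h₂ : i ≠ m) (h₃ : i ≠ tmp₃)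
    (h₄ : m ≠ tmp₁) (h₅ : m ≠ tmp₃) (h₆ : m ≠ res) (h₇ : i ≠ res) (f : Option Γ' → Bool)
    (s : Stk B → List Γ') (ht : s tmp₁ = []) :
    RunsIn (lookup i m f) s
      (update (update (update s m ((s tmp₃).reverse ++ s m)) tmp₃ []) res
        (.bit (f (s m)[(s i).length]?) :: s res))
      (8 * (s i).length + 2 * (s tmp₃).length + 6) := by
  have e : ∀ s₁ : Stk B → List Γ', s₁ m = (s m).drop (s i).length →
      RunsIn (.pop m fun o => .seq (match o with
        | none => .skip
        | some a => .push m a)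
      (.seq (move tmp₃ m) (.push res (.bit (f o))))) s₁
      (update (update (update s₁ m ((s₁ tmp₃).reverse ++ s₁ m)) tmp₃ []) res
        (.bit (f (s m)[(s i).length]?) :: s₁ res)) (2 * (s₁ tmp₃).length + 4) := by
    intro s₁ hs₁
    have e₁ : (s₁ m).head? = (s m)[(s i).length]? := by rw [hs₁, List.head?_drop]
    rw [← e₁]
    clear e₁ hs₁
    refine RunsIn.pop (T := 2 * (s₁ tmp₃).length + 3) rfl rfl ?_
    refine RunsIn.cast (T := 1 + ((2 * (s₁ tmp₃).length + 1) + 1)) (RunsIn.seq (s₁ := s₁) ?_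
      ((runsIn_move h₅.symm _).seq (RunsIn.push _ _ _))) ?_ (by omega)
    · rcases hm : s₁ m with _ | ⟨a, l⟩
      · refine (RunsIn.skip _).cast ?_ le_rfl
        funext x
        simp only [update_apply]
        split_ifs <;> simp_all
      · refine (RunsIn.push _ _ _).cast ?_ le_rfl
        funext x
        simp only [update_apply]
        split_ifs <;> simp_all
    · funext x
      simp only [update_apply]
      split_ifs <;> simp_all
  refine ((runsIn_shift h₁ h₂ h₃ h₄.symm (by simp) h₅ s).seq
    ((runsIn_move h₁.symm _).seq (e _ ?_))).cast ?_ ?_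
  · simp [h₂.symm, h₄, h₅]
  · funext x
    simp only [update_apply]
    split_ifs <;> simp_all
  · simp [update_apply, h₁, h₃, h₃.symm, h₄.symm, ht]
    omega

end StackProg

/-! ### Loops over vertices and a query language for digraphs -/

namespace StackProg

open Turing Function Computability Stk

variable {B : Type} [DecidableEq B]

/-- Run `body` once for each index below the order, the index being kept in unary on `idx i`. -/
def forEach (i : B) (body : Cmd (Stk B) Γ') : Cmd (Stk B) Γ' :=
  .seq (copy size (rem i) tmp₁) (.seq
    (.loop (rem i) (fun _ => true) fun _ => .seq body (.push (idx i) one)) (clear (idx i)))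

/-- The stacks `s` with the index `j` on `idx i` and `r` further iterations to go. -/
def withIndex (s : Stk B → List Γ') (i : B) (j r : ℕ) : Stk B → List Γ' :=
  update (update s (idx i) (List.replicate j one)) (rem i) (List.replicate r one)

/-- The family `σ` is the loop invariant: apart from the loop's own index and counter, `σ j` holds
the stacks before round `j`. Of the 9 extra steps per round, 2 belong to the loop, 5 to copying the
order to the counter and 2 to clearing the index. -/
theorem runsIn_forEach {i : B} {body : Cmd (Stk B) Γ'} {n T : ℕ} (σ : ℕ → Stk B → List Γ')
    (hsize : σ 0 size = List.replicate n one) (htmp : σ 0 tmp₁ = [])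
    (hidx : ∀ j, σ j (idx i) = []) (hrem : ∀ j, σ j (rem i) = [])
    (hbody : ∀ j r, j + r + 1 = n →
      RunsIn body (withIndex (σ j) i j r) (withIndex (σ (j + 1)) i j r) T) :
    RunsIn (forEach i body) (σ 0) (σ n) (n * (T + 9) + 4) := by
  have loop : ∀ r j, j + r = n →
      RunsIn (.loop (rem i) (fun _ => true) fun _ => .seq body (.push (idx i) one))
        (withIndex (σ j) i j r) (withIndex (σ n) i n 0) (r * (T + 2) + 1) := by
    intro r
    induction r with
    | zero =>
      rintro j rfl
      exact (RunsIn.loop_empty (by simp [withIndex])).cast rfl (by simp)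
    | succ r ih =>
      intro j hj
      have h₁ := hbody j r (by omega)
      have h₂ := ih (j + 1) (by omega)
      refine (RunsIn.loop_step (a := one) (l := List.replicate r one) (T₁ := T + 1)
        (by simp [withIndex, List.replicate_succ]) rfl ?_ h₂).cast rfl ?_
      · refine RunsIn.seq (T₂ := 1) (s₁ := withIndex (σ (j + 1)) i j r) ?_ ?_
        · refine cast ?_ h₁
          congr 1
          funext x
          simp only [withIndex, update_apply]
          split_ifs <;> simp_all
        · refine (RunsIn.push _ _ _).cast ?_ le_rfl
          funext x
          simp only [withIndex, update_apply]
          split_ifs <;> simp_all [List.replicate_succ]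
      · rw [Nat.add_mul]; omega
  have h₀ := runsIn_copy (k := (size : Stk B)) (k' := rem i) (t := tmp₁) (by simp) (by simp)
    (by simp) (σ 0) htmp
  refine (h₀.seq (RunsIn.seq (s₁ := withIndex (σ n) i n 0) (T₁ := n * (T + 2) + 1)
    (cast ?_ (loop n 0 (by omega))) (runsIn_clear _ _))).cast ?_ ?_
  · congr 1
    funext x
    have := hidx 0
    have := hrem 0
    simp only [withIndex, update_apply]
    split_ifs <;> simp_all
  · funext x
    have := hidx n
    have := hrem n
    simp only [withIndex, update_apply]
    split_ifs <;> simp_all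
  · simp [withIndex, hsize, Nat.mul_add]
    omega

/-- Advance `mat` by as many rows as there are symbols on the stack `i`. -/
def skipRows (i : Stk B) : Cmd (Stk B) Γ' :=
  .seq (.loop i (fun _ => true) fun a => .seq (.push tmp₂ a)
    (.seq (shift size tmp₁ mat tmp₃) (move tmp₁ size))) (move tmp₂ i)

/-- One row is skipped per symbol of the unary index, with `size` restored each time, so the product
of the index and the order is never computed. -/
theorem runsIn_skipRows (i : B) (s : Stk B → List Γ') (h₁ : s tmp₁ = []) (h₂ : s tmp₂ = []) :
    RunsIn (skipRows (idx i)) s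
      (update (update s mat ((s mat).drop ((s (idx i)).length * (s size).length))) tmp₃
        (((s mat).take ((s (idx i)).length * (s size).length)).reverse ++ s tmp₃))
      ((s (idx i)).length * (6 * (s size).length + 6) + 2) := by
  have loop : ∀ (l : List Γ') (s : Stk B → List Γ'), s tmp₁ = [] → s (idx i) = l →
      RunsIn (.loop (idx i) (fun _ => true) fun a => .seq (.push tmp₂ a)
          (.seq (shift size tmp₁ mat tmp₃) (move tmp₁ size))) s
        (update (update (update (update s (idx i) []) tmp₂ (l.reverse ++ s tmp₂)) mat
          ((s mat).drop (l.length * (s size).length))) tmp₃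
            (((s mat).take (l.length * (s size).length)).reverse ++ s tmp₃))
        (l.length * (6 * (s size).length + 4) + 1) := by
    intro l
    induction l with
    | nil =>
      intro s h₁ hl
      refine (RunsIn.loop_empty hl).cast ?_ (by simp)
      funext x
      simp only [update_apply]
      split_ifs <;> simp_all
    | cons a l ih =>
      intro s h₁ hl
      have h := ih (update (update (update (update s (idx i) l) tmp₂ (a :: s tmp₂)) mat
          ((s mat).drop (s size).length)) tmp₃ (((s mat).take (s size).length).reverse ++ s tmp₃))
        (by simp [h₁]) (by simp)
      refine (RunsIn.loop_step (T₁ := 6 * (s size).length + 3) hl rfl ?_ h).cast ?_ ?_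
      · refine ((RunsIn.push _ _ _).seq ((runsIn_shift (by simp) (by simp) (by simp) (by simp)
          (by simp) (by simp) _).seq (runsIn_move (by simp) _))).cast ?_ ?_
        · funext x
          simp only [update_apply]
          split_ifs <;> simp_all
        · simp [h₁]; omega
      · have e : (a :: l).length * (s size).length =
            (s size).length + l.length * (s size).length := by
          rw [List.length_cons]; ring
        rw [e]
        funext x
        simp only [update_apply]
        split_ifs <;> simp_all [List.take_add, List.drop_drop]
      · simp [Nat.add_mul]; omega
  refine ((loop _ s h₁ rfl).seq (runsIn_move (by simp) _)).cast ?_ ?_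
  · funext x
    simp only [update_apply]
    split_ifs <;> simp_all
  · simp [h₂, Nat.mul_add]; omega

/-- Boolean queries about a directed graph on `0, …, n - 1`. The index variables and the variables
for sets of vertices are named by `B`. -/
inductive Query (B : Type) : Type
  | arc (i j : B)
  | lt (i j : B)
  | mem (x i : B)
  | bin (op : Bool → Bool → Bool) (e e' : Query B)
  /-- Fold the operation `op` over the values of `e` for all indices `i`. -/
  | fold (op : Bool → Bool → Bool) (i : B) (e : Query B)
  /-- At most half of `n + 1` indices `i` satisfy `e`. -/
  | few (i : B) (e : Query B)
  /-- Evaluate `e` for the set `x` obtained from the set of all `i` satisfying `e₀` by replacing it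
  `n` times by the set of all `i` satisfying `e₁`. -/
  | iter (x i : B) (e₀ e₁ e : Query B)

namespace Query

/-- The value of a query, where `M` lists the entries of the adjacency matrix. -/
def eval (n : ℕ) (M : List Bool) : Query B → (B → ℕ) → (B → List Bool) → Bool
  | arc i j, ρ, _ => M[ρ i * n + ρ j]?.getD false
  | lt i j, ρ, _ => decide (ρ i < ρ j)
  | mem x i, ρ, V => (V x)[ρ i]?.getD false
  | bin op e e', ρ, V => op (e.eval n M ρ V) (e'.eval n M ρ V)
  | fold op i e, ρ, V =>
      (List.range n).foldl (fun b j => op b (e.eval n M (update ρ i j) V)) false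
  | few i e, ρ, V => decide
      (2 * (List.range n).countP (fun j => e.eval n M (update ρ i j) V) ≤ n + 1)
  | iter x i e₀ e₁ e, ρ, V => e.eval n M ρ (update V x
      ((fun W => (List.range n).map fun j => e₁.eval n M (update ρ i j) (update V x W))^[n]
        ((List.range n).map fun j => e₀.eval n M (update ρ i j) V)))

/-- No name is bound within its own scope, names in `L` being in use. -/
def Scoped : Query B → List B → Prop
  | arc _ _, _ => True
  | lt i j, _ => i ≠ j
  | mem _ _, _ => True
  | bin _ e e', L => e.Scoped L ∧ e'.Scoped L
  | fold _ i e, L => i ∉ L ∧ e.Scoped (i :: L)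
  | few i e, L => i ∉ L ∧ e.Scoped (i :: L)
  | iter x i e₀ e₁ e, L => x ∉ L ∧ i ∉ L ∧ i ≠ x ∧ e₀.Scoped (i :: x :: L) ∧
      e₁.Scoped (i :: x :: L) ∧ e.Scoped (x :: L)

/-- Replace the set `x` by the set of all `i` satisfying the query evaluated by `c`. -/
def tabulate (x i : B) (c : Cmd (Stk B) Γ') : Cmd (Stk B) Γ' :=
  .seq (forEach i (.seq c (.pop res fun o => match o with
      | none => .skip
      | some a => .push (buf x) a)))
    (.seq (clear (vec x)) (move (buf x) (vec x)))

/-- The command pushing the value of a query on the stack `res`. -/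
def compile : Query B → Cmd (Stk B) Γ'
  | arc i j => .seq (skipRows (idx i)) (lookup (idx j) mat isOne)
  | lt i j => lookup (idx i) (idx j) Option.isSome
  | mem x i => lookup (idx i) (vec x) isOne
  | bin op e e' => .seq e.compile (.seq e'.compile
      (.pop res fun o' => .pop res fun o => .push res (.bit (op (isOne o) (isOne o')))))
  | fold op i e => .seq (.push res (.bit false)) (forEach i (.seq e.compile
      (.pop res fun o' => .pop res fun o => .push res (.bit (op (isOne o) (isOne o'))))))
  | few i e => .seq (forEach i (.seq e.compile (.pop res fun o =>
        if isOne o then .seq (.push (buf i) one) (.push (buf i) one) else .skip)))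
      (.seq (shift size tmp₁ (buf i) tmp₃) (.seq (move tmp₁ size) (.seq (clear tmp₃)
        (.pop (buf i) fun _ => .pop (buf i) fun o => match o with
          | none => .push res (.bit true)
          | some _ => .seq (clear (buf i)) (.push res (.bit false))))))
  | iter x i e₀ e₁ e => .seq (tabulate x i e₀.compile) (.seq (copy size (rem x) tmp₁) (.seq
      (.loop (rem x) (fun _ => true) fun _ => tabulate x i e₁.compile)
        (.seq e.compile (clear (vec x)))))

open Polynomial in
/-- A bound for the running time of `tabulate`. -/
noncomputable def tabulateCost (p : ℕ[X]) : ℕ[X] := X * (p + C 15) + C 6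

open Polynomial in
/-- A bound for the running time of the command computing a query. -/
noncomputable def cost : Query B → ℕ[X]
  | arc _ _ => C 8 * X ^ 2 + C 14 * X + C 8
  | lt _ _ => C 8 * X + C 6
  | mem _ _ => C 8 * X + C 6
  | bin _ e e' => e.cost + e'.cost + C 3
  | fold _ _ e => X * (e.cost + C 12) + C 5
  | few _ e => X * (e.cost + C 24) + C 12
  | iter _ _ e₀ e₁ e => tabulateCost e₀.cost + C 7 * X + X * (tabulateCost e₁.cost + C 1) + e.cost
      + C 4

end Query

/-- The stacks `s` represent the graph with adjacency matrix `M` of order `n`, and the values `ρ`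
and `V` of the variables. -/
structure Represents (n : ℕ) (M : List Bool) (ρ : B → ℕ) (V : B → List Bool)
    (s : Stk B → List Γ') : Prop where
  size : s size = List.replicate n one
  mat : s mat = M.map Γ'.bit
  tmp₁ : s tmp₁ = []
  tmp₂ : s tmp₂ = []
  tmp₃ : s tmp₃ = []
  idx : ∀ b, s (idx b) = List.replicate (ρ b) one
  vec : ∀ b, s (vec b) = (V b).map Γ'.bit
  le : ∀ b, ρ b ≤ n

/-- The stacks of all names that are not in `L` are empty. -/
def Fresh (L : List B) (s : Stk B → List Γ') : Prop :=
  ∀ b, b ∉ L → s (idx b) = [] ∧ s (rem b) = [] ∧ s (vec b) = [] ∧ s (buf b) = []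

/-- Used on entering the scope of an index. Results, counters and buffers may differ, since they do
not take part in the representation. -/
theorem Represents.withIndex {n : ℕ} {M : List Bool} {ρ : B → ℕ} {V : B → List Bool}
    {s s' : Stk B → List Γ'} (h : Represents n M ρ V s) {i : B} {j r : ℕ} (hj : j ≤ n)
    (h₁ : ∀ k, k ≠ res → (∀ b, k ≠ rem b) → (∀ b, k ≠ buf b) → s' k = s k) :
    Represents n M (update ρ i j) V (withIndex s' i j r) where
  size := by simp [StackProg.withIndex, h₁, h.size]
  mat := by simp [StackProg.withIndex, h₁, h.mat]
  tmp₁ := by simp [StackProg.withIndex, h₁, h.tmp₁]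
  tmp₂ := by simp [StackProg.withIndex, h₁, h.tmp₂]
  tmp₃ := by simp [StackProg.withIndex, h₁, h.tmp₃]
  idx b := by
    by_cases hb : b = i
    · subst hb; simp [StackProg.withIndex]
    · simp [StackProg.withIndex, hb, h₁, h.idx]
  vec b := by simp [StackProg.withIndex, h₁, h.vec]
  le b := by
    by_cases hb : b = i
    · subst hb; simpa
    · simp [hb, h.le]

theorem Represents.update_vec {n : ℕ} {M : List Bool} {ρ : B → ℕ} {V : B → List Bool}
    {s s' : Stk B → List Γ'} (h : Represents n M ρ V s) (x : B) (W : List Bool)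
    (h₁ : ∀ k, k ≠ res → (∀ b, k ≠ rem b) → (∀ b, k ≠ buf b) → k ≠ Stk.vec x → s' k = s k)
    (h₂ : s' (Stk.vec x) = W.map Γ'.bit) : Represents n M ρ (update V x W) s' where
  size := by simp [h₁, h.size]
  mat := by simp [h₁, h.mat]
  tmp₁ := by simp [h₁, h.tmp₁]
  tmp₂ := by simp [h₁, h.tmp₂]
  tmp₃ := by simp [h₁, h.tmp₃]
  idx b := by simp [h₁, h.idx]
  vec b := by
    by_cases hb : b = x
    · subst hb; simp [h₂]
    · simp [hb, h₁, h.vec]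
  le b := h.le b

theorem Fresh.withIndex {L : List B} {s s' : Stk B → List Γ'} (h : Fresh L s) {i : B} {j r : ℕ}
    (h₁ : ∀ b, b ∉ L → b ≠ i → s' (idx b) = s (idx b) ∧ s' (rem b) = s (rem b) ∧
      s' (vec b) = s (vec b) ∧ s' (buf b) = s (buf b)) :
    Fresh (i :: L) (withIndex s' i j r) := by
  intro b hb
  simp only [List.mem_cons, not_or] at hb
  obtain ⟨e₁, e₂, e₃, e₄⟩ := h₁ b hb.2 hb.1
  obtain ⟨f₁, f₂, f₃, f₄⟩ := h b hb.2
  simp [StackProg.withIndex, hb.1, e₁, e₂, e₃, e₄, f₁, f₂, f₃, f₄]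

theorem Fresh.mono {B : Type} {L L' : List B} {s : Stk B → List Γ'} (h : Fresh L s) (hL : L ⊆ L') :
    Fresh L' s := fun b hb => h b fun hb' => hb (hL hb')

end StackProg

/-! ### Correctness and cost of compiled queries -/

namespace StackProg

open Turing Function Computability Stk

variable {B : Type} [DecidableEq B]

theorem runsIn_combine (op : Bool → Bool → Bool) {b b' : Bool} {l : List Γ'}
    {s : Stk B → List Γ'} (h : s res = .bit b' :: .bit b :: l) :
    RunsIn (.pop res fun o' => .pop res fun o => .push res (.bit (op (isOne o) (isOne o')))) s
      (update s res (.bit (op b b') :: l)) 3 := by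
  refine RunsIn.pop (T := 2) (o := some (.bit b')) (l := .bit b :: l) (by simp [h]) (by simp [h])
    (RunsIn.pop (T := 1) (o := some (.bit b)) (l := l) (by simp) (by simp)
      ((RunsIn.push _ _ _).cast ?_ le_rfl))
  simp

/-- The new entries gather on `buf x` while `c` still reads the old set on `vec x`, so all of them
are computed from the same set; hence `hc` must allow any content `l` of the buffer. They arrive in
reverse order, which the final move undoes. -/
theorem Query.runsIn_tabulate {n T : ℕ} {x i : B} {c : Cmd (Stk B) Γ'} {s : Stk B → List Γ'}
    (val : ℕ → Bool) (hsize : s size = List.replicate n one) (htmp : s tmp₁ = [])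
    (hidx : s (idx i) = []) (hrem : s (rem i) = []) (hbuf : s (buf x) = [])
    (hvec : (s (vec x)).length ≤ n)
    (hc : ∀ j r l, j + r + 1 = n → RunsIn c (withIndex (update s (buf x) l) i j r)
      (update (withIndex (update s (buf x) l) i j r) res (.bit (val j) :: s res)) T) :
    RunsIn (tabulate x i c) s
      (update s (vec x) (((List.range n).map val).map Γ'.bit)) (n * (T + 15) + 6) := by
  have h := runsIn_forEach (i := i) (n := n) (T := T + 2) (body := .seq c (.pop res fun o =>
      match o with
      | none => .skip
      | some a => .push (buf x) a))
    (fun j => update s (buf x) (((List.range j).map val).map Γ'.bit).reverse)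
    (by simp [hsize]) (by simp [htmp]) (by simp [hidx]) (by simp [hrem]) ?_
  · have e : update s (buf x) (((List.range 0).map val).map Γ'.bit).reverse = s := by
      rw [show (((List.range 0).map val).map Γ'.bit).reverse = s (buf x) by simp [hbuf],
        update_eq_self]
    rw [e] at h
    refine (h.seq ((runsIn_clear _ _).seq (runsIn_move (by simp) _))).cast ?_ ?_
    · funext y
      simp only [update_apply]
      split_ifs <;> simp_all
    · simp only [ne_eq, reduceCtorEq, not_false_eq_true, update_of_ne, update_self,
        List.length_reverse, List.length_map, List.length_range, Nat.mul_add]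
      omega
  · intro j r hj
    refine (hc j r _ hj).seq (RunsIn.pop (T := 1) (o := some (.bit (val j))) (l := s res)
      (by simp) (by simp) ?_)
    refine (RunsIn.push _ _ _).cast ?_ le_rfl
    funext y
    simp only [withIndex, update_apply]
    split_ifs <;> simp_all [List.range_succ]

/-- The induction works because a compiled query leaves every stack as it was, apart from one new
bit on `res`. Scoping guarantees that the stacks of a newly bound name are empty and belong to no
enclosing scope. -/
theorem Query.runsIn_compile {n : ℕ} {M : List Bool} (e : Query B) :
    ∀ (L : List B) (ρ : B → ℕ) (V : B → List Bool) (s : Stk B → List Γ'), e.Scoped L →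
      Represents n M ρ V s → Fresh L s →
      RunsIn e.compile s (update s res (.bit (e.eval n M ρ V) :: s res)) (e.cost.eval n) := by
  induction e with
  | arc i j =>
    intro L ρ V s _ h _
    refine ((runsIn_skipRows i s h.tmp₁ h.tmp₂).seq (runsIn_lookup (by simp) (by simp) (by simp)
      (by simp) (by simp) (by simp) (by simp) isOne _ (by simp [h.tmp₁]))).cast ?_ ?_
    · have e : isOne (M.map Γ'.bit)[ρ i * n + ρ j]? = M[ρ i * n + ρ j]?.getD false := by
        rw [List.getElem?_map]
        cases M[ρ i * n + ρ j]? <;> simp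
      funext x
      have h₁ := h.mat
      have h₂ := h.idx i
      have h₃ := h.idx j
      have h₄ := h.size
      have h₅ := h.tmp₃
      simp only [update_apply, eval, ← e]
      split_ifs <;> simp_all
    · have h₁ := h.le i
      have h₂ := h.le j
      have h₃ : ρ i * n ≤ n * n := Nat.mul_le_mul_right n h₁
      have h₄ : ρ i * (6 * n + 6) ≤ n * (6 * n + 6) := Nat.mul_le_mul_right _ h₁
      simp only [h.tmp₃, h.idx, h.size, h.mat, List.length_replicate, ne_eq, reduceCtorEq,
        not_false_eq_true, update_of_ne, update_self, List.append_nil, List.length_reverse,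
        List.length_take, List.length_map, cost, Polynomial.eval_add, Polynomial.eval_mul,
        Polynomial.eval_C, Polynomial.eval_X, pow_two]
      have h₅ : min (ρ i * n) M.length ≤ ρ i * n := min_le_left _ _
      have h₆ : n * (6 * n + 6) = 6 * (n * n) + 6 * n := by ring
      omega
  | lt i j =>
    intro L ρ V s hij h _
    refine (runsIn_lookup (by simp) (by simpa [Scoped] using hij) (by simp)
      (by simp) (by simp) (by simp) (by simp) _ _ h.tmp₁).cast ?_ ?_
    · funext x
      have h₂ := h.idx i
      have h₃ := h.idx j
      have h₅ := h.tmp₃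
      simp only [update_apply, eval]
      split_ifs <;> simp_all
      rw [List.getElem?_replicate]
      split_ifs <;> simp_all
    · have h₁ := h.le i
      simp [h.idx, h.tmp₃, cost]
      omega
  | mem x i =>
    intro L ρ V s _ h _
    refine (runsIn_lookup (by simp) (by simp) (by simp)
      (by simp) (by simp) (by simp) (by simp) _ _ h.tmp₁).cast ?_ ?_
    · have e : isOne ((V x).map Γ'.bit)[ρ i]? = (V x)[ρ i]?.getD false := by
        rw [List.getElem?_map]
        cases (V x)[ρ i]? <;> simp
      funext y
      have h₂ := h.idx i
      have h₃ := h.vec x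
      have h₅ := h.tmp₃
      simp only [update_apply, eval, ← e]
      split_ifs <;> simp_all
    · have h₁ := h.le i
      simp [h.idx, h.tmp₃, cost]
      omega
  | bin op e e' ihe ihe' =>
    intro L ρ V s hL h hF
    have h₁ := ihe L ρ V s hL.1 h hF
    have h₂ := ihe' L ρ V (s := update s res (.bit (e.eval n M ρ V) :: s res)) hL.2
      ⟨by simp [h.size], by simp [h.mat], by simp [h.tmp₁], by simp [h.tmp₂], by simp [h.tmp₃],
        by simp [h.idx], by simp [h.vec], h.le⟩ (fun b hb => by simpa using hF b hb)
    refine (h₁.seq (h₂.seq (runsIn_combine op (l := s res) (b := e.eval n M ρ V)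
      (b' := e'.eval n M ρ V) (by simp)))).cast ?_ ?_
    · simp [eval]
    · simp [cost]; omega
  | fold op i e ih =>
    intro L ρ V s hL h hF
    obtain ⟨f₁, f₂, -, -⟩ := hF i hL.1
    -- The fold over the first `k` indices, which stays on top of `res` during the loop.
    set acc : ℕ → Bool := fun k =>
      (List.range k).foldl (fun b j => op b (e.eval n M (update ρ i j) V)) false with hacc
    refine ((RunsIn.push _ _ _).seq (runsIn_forEach (i := i) (n := n) (T := e.cost.eval n + 3)
      (fun j => update s res (.bit (acc j) :: s res)) (by simp [h.size]) (by simp [h.tmp₁])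
        (by simp [f₁]) (by simp [f₂]) ?_)).cast rfl ?_
    · intro j r hj
      have h₁ := ih (i :: L) (update ρ i j) V
        (withIndex (update s res (.bit (acc j) :: s res)) i j r) hL.2
        (h.withIndex (by omega) (by simp +contextual)) (hF.withIndex (by simp))
      refine (h₁.seq (runsIn_combine op (l := s res) (b := acc j)
        (b' := e.eval n M (update ρ i j) V) (by simp [withIndex]))).cast
        ?_ le_rfl
      funext x
      simp only [withIndex, update_apply]
      split_ifs <;> simp_all [List.range_succ]
    · simp [cost]; ring_nf; rfl
  | few i e ih =>
    intro L ρ V s hL h hF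
    obtain ⟨f₁, f₂, -, f₄⟩ := hF i hL.1
    set cnt : ℕ → ℕ := fun k =>
      (List.range k).countP (fun j => e.eval n M (update ρ i j) V) with hcnt
    have loop := runsIn_forEach (i := i) (n := n) (T := e.cost.eval n + 3)
      (body := .seq e.compile (.pop res fun o =>
        if isOne o then .seq (.push (buf i) one) (.push (buf i) one) else .skip))
      (fun j => update s (buf i) (List.replicate (2 * cnt j) one)) (by simp [h.size])
        (by simp [h.tmp₁]) (by simp [f₁]) (by simp [f₂]) ?_
    · have e₀ : update s (buf i) (List.replicate (2 * cnt 0) one) = s := by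
        simp [hcnt, ← f₄]
      rw [e₀] at loop
      have hle : cnt n ≤ n := by
        simpa using List.countP_le_length (l := List.range n)
          (p := fun j => e.eval n M (update ρ i j) V)
      -- Each hit pushed two symbols, and `n` of them have been removed by `shift`. Of the remaining
      -- `2 * cnt n - n` one more is discarded, so the second pop finds a symbol iff `2 * cnt n > n
      -- + 1`.
      have fin : ∀ s₁ : Stk B → List Γ', s₁ (buf i) = List.replicate (2 * cnt n - n) one →
          RunsIn (.pop (buf i) fun _ => .pop (buf i) fun o => match o with
            | none => .push res (.bit true)
            | some _ => .seq (clear (buf i)) (.push res (.bit false))) s₁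
            (update (update s₁ (buf i) []) res
              (.bit (decide (2 * cnt n ≤ n + 1)) :: s₁ res)) (2 * n + 4) := by
        intro s₁ hs₁
        refine RunsIn.pop (T := 2 * n + 3) rfl rfl ?_
        refine RunsIn.pop (T := 2 * n + 2) rfl rfl ?_
        by_cases hc : 2 * cnt n ≤ n + 1
        · have e₁ : (update s₁ (buf i) (s₁ (buf i)).tail (buf i)) = [] := by
            simp [hs₁]; omega
          rw [e₁]
          refine (RunsIn.push _ _ _).cast ?_ (by omega)
          simp [hc]
        · obtain ⟨k, hk⟩ : ∃ k, 2 * cnt n - n = k + 2 := ⟨2 * cnt n - n - 2, by omega⟩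
          have e₁ : (update s₁ (buf i) (s₁ (buf i)).tail (buf i)) =
              one :: List.replicate k one := by
            simp [hs₁, hk, List.replicate_succ]
          rw [e₁]
          refine ((runsIn_clear _ _).seq (RunsIn.push _ _ _)).cast ?_ ?_
          · simp [hc]
          · simp; omega
      refine (loop.seq ((runsIn_shift (by simp) (by simp) (by simp) (by simp) (by simp) (by simp)
        _).seq ((runsIn_move (by simp) _).seq ((runsIn_clear _ _).seq (fin _ ?_))))).cast ?_ ?_
      · simp [h.size, List.drop_replicate]
      · funext x
        have h₁ := h.size
        have h₂ := h.tmp₁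
        have h₃ := h.tmp₃
        simp only [update_apply, eval]
        split_ifs <;> simp_all
      · simp [h.size, h.tmp₁, h.tmp₃, cost]
        ring_nf
        omega
    · intro j r hj
      have h₁ := ih (i :: L) (update ρ i j) V
        (withIndex (update s (buf i) (List.replicate (2 * cnt j) one)) i j r) hL.2
        (h.withIndex (by omega) (by simp +contextual)) (hF.withIndex (by simp +contextual))
      refine h₁.seq (T₂ := 3) (RunsIn.pop (T := 2)
        (o := some (.bit (e.eval n M (update ρ i j) V))) (l := s res) (by simp)
          (by simp [withIndex]) ?_)
      rcases hv : e.eval n M (update ρ i j) V with _ | _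
      · refine (RunsIn.skip _).cast ?_ (by omega)
        funext x
        simp only [withIndex, update_apply]
        split_ifs <;> simp_all [List.range_succ]
      · refine ((RunsIn.push _ _ _).seq (RunsIn.push _ _ _)).cast ?_ le_rfl
        funext x
        simp only [withIndex, update_apply]
        split_ifs <;> simp_all [List.range_succ, Nat.mul_add, List.replicate_succ]
  | iter x i e₀ e₁ e ih₀ ih₁ ih =>
    intro L ρ V s hL h hF
    obtain ⟨hx, hi, hix, hL₀, hL₁, hL₂⟩ := hL
    obtain ⟨f₁, f₂, f₃, f₄⟩ := hF i hi
    obtain ⟨g₁, g₂, g₃, g₄⟩ := hF x hx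
    set F : List Bool → List Bool := fun W =>
      (List.range n).map fun j => e₁.eval n M (update ρ i j) (update V x W) with hF'
    set W₀ := (List.range n).map fun j => e₀.eval n M (update ρ i j) V with hW₀
    have hlen : ∀ k, (F^[k] W₀).length = n := by
      intro k
      cases k with
      | zero => simp [hW₀]
      | succ k => rw [iterate_succ_apply']; simp [hF']
    have step₀ := runsIn_tabulate (x := x) (i := i) (c := e₀.compile) (n := n)
      (T := e₀.cost.eval n) (s := s)
      (fun j => e₀.eval n M (update ρ i j) V) h.size h.tmp₁ f₁ f₂ g₄ (by simp [g₃]) (by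
        intro j r l hj
        refine (ih₀ (i :: x :: L) (update ρ i j) V _ hL₀ (h.withIndex (by omega)
          (by simp +contextual)) ?_).cast ?_ le_rfl
        · exact (hF.mono (List.subset_cons_self x L)).withIndex (by simp +contextual)
        · simp [withIndex])
    -- The stacks after `k` replacements of the set, with `r` still to be done.
    let S : ℕ → ℕ → Stk B → List Γ' := fun k r =>
      update (update s (vec x) ((F^[k] W₀).map Γ'.bit)) (rem x) (List.replicate r one)
    have step : ∀ k r, RunsIn (tabulate x i e₁.compile) (S k r) (S (k + 1) r)
        (n * (e₁.cost.eval n + 15) + 6) := by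
      intro k r
      refine (runsIn_tabulate (x := x) (i := i) (c := e₁.compile) (n := n)
        (T := e₁.cost.eval n) (s := S k r)
        (fun j => e₁.eval n M (update ρ i j) (update V x (F^[k] W₀))) (by simp [S, h.size])
        (by simp [S, h.tmp₁]) (by simp [S, f₁]) (by simp [S, f₂, hix]) (by simp [S, g₄])
        (by simp [S, hlen]) ?_).cast ?_ le_rfl
      · intro j r' l hj
        have hR : Represents n M ρ (update V x (F^[k] W₀)) (S k r) :=
          h.update_vec x _ (by simp +contextual [S]) (by simp [S])
        refine (ih₁ (i :: x :: L) (update ρ i j) (update V x (F^[k] W₀)) _ hL₁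
          (hR.withIndex (by omega) (by simp +contextual)) ?_).cast ?_ le_rfl
        · exact (hF.mono (List.subset_cons_self x L)).withIndex (by simp +contextual [S])
        · simp [withIndex]
      · funext y
        have : F^[k + 1] W₀ = F (F^[k] W₀) := iterate_succ_apply' F k W₀
        simp only [S, update_apply, this]
        split_ifs <;> simp_all
    have loop : ∀ r k, k + r = n →
        RunsIn (.loop (rem x) (fun _ => true) fun _ => tabulate x i e₁.compile) (S k r) (S n 0)
          (r * (n * (e₁.cost.eval n + 15) + 6 + 1) + 1) := by
      intro r
      induction r with
      | zero =>
        rintro k rfl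
        exact (RunsIn.loop_empty (by simp [S])).cast rfl (by simp)
      | succ r ihr =>
        intro k hk
        refine (RunsIn.loop_step (a := one) (l := List.replicate r one) (s₁ := S (k + 1) r)
          (T₁ := n * (e₁.cost.eval n + 15) + 6)
          (by simp [S, List.replicate_succ]) rfl ?_ (ihr (k + 1) (by omega))).cast rfl ?_
        · convert step k r using 1
          simp [S]
        · rw [Nat.add_mul r]; omega
    have hR : Represents n M ρ (update V x (F^[n] W₀)) (S n 0) :=
      h.update_vec x _ (by simp +contextual [S]) (by simp [S])
    have last := ih (x :: L) ρ (update V x (F^[n] W₀)) (S n 0) hL₂ hR (by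
      intro b hb
      simp only [List.mem_cons, not_or] at hb
      simpa [S, hb.1] using hF b hb.2)
    refine (step₀.seq ((runsIn_copy (by simp) (by simp) (by simp) _ (by simp [h.tmp₁])).seq
      (RunsIn.seq (s₁ := S n 0)
      (T₁ := n * (n * (e₁.cost.eval n + 15) + 6 + 1) + 1) (cast ?_ (loop n 0 (by omega))) (last.seq
        (runsIn_clear _ _))))).cast ?_ ?_
    · congr 1
      funext y
      have := h.size
      simp only [S, update_apply]
      split_ifs <;> simp_all
    · funext y
      have : S n 0 = update s (vec x) ((F^[n] W₀).map Γ'.bit) := by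
        simp [S, ← g₂]
      rw [this]
      simp only [update_apply, eval]
      split_ifs <;> simp_all
    · simp [S, h.size, hlen, cost, tabulateCost, Nat.mul_add]
      ring_nf
      omega

end StackProg

/-! ### Reading the input and comparing the order with a binary number -/

namespace StackProg

open Turing Function Computability Stk

/-- The value of a list of binary digits, the least significant one coming first. -/
def binVal : List Bool → ℕ
  | [] => 0
  | b :: l => b.toNat + 2 * binVal l

variable {B : Type} [DecidableEq B]

/-- Read the digits of the binary number and move them to `tmp₂`, and read the rows of the matrix,
counting them on `size`. -/
def parse : Cmd (Stk B) Γ' :=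
  .seq (.loop inp (fun a => a ≠ Γ'.comma) fun a => .push tmp₁ a) (.seq (move tmp₁ tmp₂)
    (.seq (.loop inp (fun _ => true) fun a => if a = Γ'.comma then .push size one else .push tmp₁ a)
      (move tmp₁ mat)))

/-- The input string for a binary number and a matrix. -/
def inputString (bits : List Bool) (rows : List (List Bool)) : List Γ' :=
  bits.map Γ'.bit ++ Γ'.comma :: rows.flatMap fun r => r.map Γ'.bit ++ [Γ'.comma]

/-- The order is not written in the input. It is recovered in unary by counting the commas that end
the rows. Passing through `tmp₁` restores the original sequence of digits and of entries. -/
theorem runsIn_parse (bits : List Bool) (rows : List (List Bool)) :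
    RunsIn parse (update (fun _ => []) inp (inputString bits rows))
      (update (update (update (fun _ : Stk B => []) tmp₂ (bits.map Γ'.bit)) size
        (List.replicate rows.length one)) mat (rows.flatten.map Γ'.bit))
      (4 * (inputString bits rows).length + 4) := by
  have loop₁ : ∀ (bits : List Bool) (l : List Γ') (s : Stk B → List Γ'),
      s inp = bits.map Γ'.bit ++ Γ'.comma :: l →
      RunsIn (.loop inp (fun a => a ≠ Γ'.comma) fun a => .push tmp₁ a) s
        (update (update s inp l) tmp₁ ((bits.map Γ'.bit).reverse ++ s tmp₁))
          (2 * bits.length + 1) := by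
    intro bits
    induction bits with
    | nil =>
      intro l s h
      refine (RunsIn.loop_exit h (by simp)).cast ?_ (by simp)
      funext x
      simp only [update_apply]
      split_ifs <;> simp_all
    | cons b bits ih =>
      intro l s h
      refine (RunsIn.loop_step h (by simp) (RunsIn.push _ _ _) (ih l _ (by simp))).cast ?_
        (by simp; omega)
      funext x
      simp only [update_apply]
      split_ifs <;> simp_all
  have row : ∀ (r : List Bool) (l : List Γ') (s s' : Stk B → List Γ') (T : ℕ),
      s inp = r.map Γ'.bit ++ Γ'.comma :: l →
      RunsIn (.loop inp (fun _ => true) fun a =>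
          if a = Γ'.comma then .push size one else .push tmp₁ a)
        (update (update (update s inp l) tmp₁ ((r.map Γ'.bit).reverse ++ s tmp₁)) size
          (one :: s size)) s' T →
      RunsIn (.loop inp (fun _ => true) fun a =>
          if a = Γ'.comma then .push size one else .push tmp₁ a) s s'
          (2 * r.length + 2 + T) := by
    intro r
    induction r with
    | nil =>
      intro l s s' T h h'
      refine (RunsIn.loop_step (T₁ := 1) (T₂ := T) (g := fun _ => true)
        (s₁ := update (update s inp l) size (one :: s size)) h rfl ?_ (cast ?_ h')).cast
        rfl (by simp)
      · simpa using RunsIn.push (update s inp l) size one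
      congr 1
      funext x
      simp only [update_apply]
      split_ifs <;> simp_all
    | cons b r ih =>
      intro l s s' T h h'
      refine (RunsIn.loop_step (T₁ := 1)
        (s₁ := update (update s inp (r.map Γ'.bit ++ Γ'.comma :: l)) tmp₁ (.bit b :: s tmp₁))
        h rfl ?_ (ih l _ _ T (by simp) (cast ?_ h'))).cast rfl (by simp; omega)
      · simpa using RunsIn.push (update s inp (r.map Γ'.bit ++ Γ'.comma :: l)) tmp₁ (.bit b)
      · congr 1
        funext x
        simp only [update_apply]
        split_ifs <;> simp_all
  have loop₂ : ∀ (rows : List (List Bool)) (s : Stk B → List Γ'),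
      s inp = rows.flatMap (fun r => r.map Γ'.bit ++ [Γ'.comma]) →
      RunsIn (.loop inp (fun _ => true) fun a =>
          if a = Γ'.comma then .push size one else .push tmp₁ a) s
        (update (update (update s inp []) tmp₁ ((rows.flatten.map Γ'.bit).reverse ++ s tmp₁)) size
          (List.replicate rows.length one ++ s size))
        (2 * rows.flatten.length + 2 * rows.length + 1) := by
    intro rows
    induction rows with
    | nil =>
      intro s h
      refine (RunsIn.loop_empty h).cast ?_ (by simp)
      funext x
      simp only [update_apply]
      split_ifs <;> simp_all
    | cons r rows ih =>
      intro s h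
      refine (row r _ s _ _ (by simpa using h) (ih _ (by simp))).cast ?_ (by simp; omega)
      funext x
      simp only [update_apply]
      split_ifs <;> simp_all [List.replicate_succ']
  refine ((loop₁ bits _ _ (by simp [inputString]; rfl)).seq ((runsIn_move (by simp) _).seq
    ((loop₂ rows _ (by simp)).seq (runsIn_move (by simp) _)))).cast ?_ ?_
  · funext x
    simp only [update_apply]
    split_ifs <;> simp_all
  · have : (rows.flatMap fun r => r.map Γ'.bit ++ [Γ'.comma]).length =
        rows.flatten.length + rows.length := by
      induction rows with
      | nil => simp
      | cons r rows ih => simp [List.flatMap_cons, ih]; omega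
    simp only [inputString, List.length_append, List.length_cons, this, ne_eq, reduceCtorEq,
      not_false_eq_true, update_of_ne, update_self, List.length_map, List.length_reverse,
      List.append_nil]
    omega

/-- Halve the number on `tmp₃`. -/
def halve : Cmd (Stk B) Γ' :=
  .seq (.loop tmp₃ (fun _ => true) fun _ => .pop tmp₃ fun o => match o with
    | none => .skip
    | some a => .push tmp₁ a) (move tmp₁ tmp₃)

theorem runsIn_halve (m : ℕ) (s : Stk B → List Γ') (h₁ : s tmp₁ = [])
    (h₃ : s tmp₃ = List.replicate m one) :
    RunsIn halve s (update s tmp₃ (List.replicate (m / 2) one)) (3 * m + 5) := by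
  -- The bound `k` only drives the induction, as each round lowers `m` by two.
  have loop : ∀ (k m : ℕ) (s : Stk B → List Γ'), m < 2 * k → s tmp₃ = List.replicate m one →
      RunsIn (.loop tmp₃ (fun _ => true) fun _ => .pop tmp₃ fun o => match o with
        | none => .skip
        | some a => .push tmp₁ a) s
      (update (update s tmp₃ []) tmp₁ (List.replicate (m / 2) one ++ s tmp₁)) (2 * m + 3) := by
    intro k
    induction k with
    | zero => intro m s hm; omega
    | succ k ih =>
      intro m s hm h
      rcases m with _ | _ | m
      · refine (RunsIn.loop_empty h).cast ?_ (by omega)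
        funext x
        simp only [update_apply]
        split_ifs <;> simp_all
      · refine (RunsIn.loop_step (T₁ := 2) (s₁ := update s tmp₃ []) h rfl ?_
          (RunsIn.loop_empty (by simp))).cast ?_ (by omega)
        · exact RunsIn.pop (T := 1) (o := none) (l := []) (by simp) (by simp)
            ((RunsIn.skip _).cast (by simp) le_rfl)
        · funext x
          simp only [update_apply]
          split_ifs <;> simp_all
      · refine (RunsIn.loop_step (T₁ := 2)
          (s₁ := update (update s tmp₃ (List.replicate m one)) tmp₁ (one :: s tmp₁)) h rfl ?_
          (ih m _ (by omega) (by simp))).cast ?_ (by omega)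
        · exact RunsIn.pop (T := 1) (o := some one) (l := List.replicate m one)
            (by simp [List.replicate_succ]) (by simp) ((RunsIn.push _ _ _).cast (by simp) le_rfl)
        · have : (m + 1 + 1) / 2 = m / 2 + 1 := by omega
          rw [this]
          funext x
          simp only [update_apply]
          split_ifs <;> simp_all [List.replicate_succ']
  refine ((loop (m + 1) m s (by omega) h₃).seq (runsIn_move (by simp) _)).cast ?_ ?_
  · funext x
    simp only [update_apply]
    split_ifs <;> simp_all
  · simp [h₁]; omega

/-- The result of halving `m`, rounded according to the given bits. -/
def halves : List Bool → ℕ → ℕ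
  | [], m => m
  | b :: l, m => halves l ((m + (!b).toNat) / 2)

/-- For a digit b, m ≤ b + 2v iff ⌈(m - b)/2⌉ ≤ v, and the rounded half in `halves` is this ceiling.
The comparison thus consumes the digits one by one; writing the binary number in unary could take
exponentially many symbols. -/
theorem halves_eq_zero (l : List Bool) (m : ℕ) : halves l m = 0 ↔ m ≤ binVal l := by
  induction l generalizing m with
  | nil => simp [halves, binVal]
  | cons b l ih =>
    rw [halves, ih, binVal]
    cases b <;> simp <;> omega

theorem halves_le (l : List Bool) (m : ℕ) : halves l m ≤ m := by
  induction l generalizing m with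
  | nil => exact le_rfl
  | cons b l ih =>
    refine (ih _).trans ?_
    cases b <;> simp <;> omega

/-- Push on `res` whether the order is at most the binary number on `tmp₂`, which is consumed. -/
def compareSize : Cmd (Stk B) Γ' :=
  .seq (copy size tmp₃ tmp₁) (.seq
    (.loop tmp₂ (fun _ => true) fun b =>
      .seq (if b = one then .skip else .push tmp₃ one) halve)
    (.pop tmp₃ fun o => .seq (.push res (.bit o.isNone)) (clear tmp₃)))

theorem runsIn_compareSize (bits : List Bool) (n : ℕ) (s : Stk B → List Γ') (h₁ : s tmp₁ = [])
    (h₂ : s tmp₂ = bits.map Γ'.bit) (h₃ : s tmp₃ = []) (h₄ : s size = List.replicate n one) :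
    RunsIn compareSize s
      (update (update s tmp₂ []) res (.bit (decide (n ≤ binVal bits)) :: s res))
      (bits.length * (3 * n + 10) + 7 * n + 6) := by
  have loop : ∀ (bits : List Bool) (m : ℕ) (s : Stk B → List Γ'), m ≤ n → s tmp₁ = [] →
      s tmp₂ = bits.map Γ'.bit → s tmp₃ = List.replicate m one →
      RunsIn (.loop tmp₂ (fun _ => true) fun b =>
          .seq (if b = one then .skip else .push tmp₃ one) halve) s
        (update (update s tmp₂ []) tmp₃ (List.replicate (halves bits m) one))
        (bits.length * (3 * n + 10) + 1) := by
    intro bits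
    induction bits with
    | nil =>
      intro m s hm h₁ h₂ h₃
      refine (RunsIn.loop_empty h₂).cast ?_ (by simp)
      funext x
      simp only [update_apply, halves]
      split_ifs <;> simp_all
    | cons b bits ih =>
      intro m s hm h₁ h₂ h₃
      refine (RunsIn.loop_step (T₁ := 3 * n + 9)
        (s₁ := update (update s tmp₂ (bits.map Γ'.bit)) tmp₃
          (List.replicate ((m + (!b).toNat) / 2) one)) h₂ rfl ?_
        (ih ((m + (!b).toNat) / 2) _ (by cases b <;> simp <;> omega) (by simp [h₁]) (by simp)
          (by simp))).cast ?_ (by simp [Nat.add_mul]; omega)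
      · refine (RunsIn.seq (T₁ := 1) (s₁ := update (update s tmp₂ (bits.map Γ'.bit)) tmp₃
          (List.replicate (m + (!b).toNat) one)) ?_
            (runsIn_halve (m + (!b).toNat) _ (by simp [h₁]) (by simp))).cast ?_ ?_
        · cases b
          · refine (RunsIn.push _ _ _).cast ?_ le_rfl
            simp [h₃, List.replicate_succ]
          · refine (RunsIn.skip _).cast ?_ le_rfl
            simp [← h₃]
        · simp
        · cases b <;> simp <;> omega
      · simp only [halves]
        funext x
        simp only [update_apply]
        split_ifs <;> simp_all
  have last : ∀ s₁ : Stk B → List Γ', s₁ tmp₃ = List.replicate (halves bits n) one →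
      RunsIn (.pop tmp₃ fun o => .seq (.push res (.bit o.isNone)) (clear tmp₃)) s₁
        (update (update s₁ tmp₃ []) res (.bit (decide (n ≤ binVal bits)) :: s₁ res))
        (2 * n + 3) := by
    intro s₁ h
    have hle := halves_le bits n
    refine RunsIn.pop (T := 2 * n + 2) rfl rfl ?_
    refine ((RunsIn.push _ _ _).seq (runsIn_clear _ _)).cast ?_ ?_
    · have : (s₁ tmp₃).head?.isNone = decide (n ≤ binVal bits) := by
        rw [h, ← decide_eq_decide.mpr (halves_eq_zero bits n)]
        have : ∀ m, (List.replicate m one).head?.isNone = decide (m = 0) := by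
          intro m
          cases m <;> simp [List.replicate_succ]
        exact this _
      rw [this]
      funext x
      simp only [update_apply]
      split_ifs <;> simp_all
    · simp [h]; omega
  refine ((runsIn_copy (by simp) (by simp) (by simp) s h₁).seq ((loop bits n _ le_rfl (by simp [h₁])
    (by simp [h₂]) (by simp [h₃, h₄])).seq (last _ (by simp)))).cast ?_ ?_
  · funext x
    simp only [update_apply]
    split_ifs <;> simp_all
  · simp [h₄]; omega

/-- Push the symbol, if any, on the stack `k`. -/
def pushOption (k : Stk B) : Option Γ' → Cmd (Stk B) Γ'
  | none => .skip
  | some a => .push k a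

theorem runsIn_pushOption (k : Stk B) (o : Option Γ') (s : Stk B → List Γ') :
    RunsIn (pushOption k o) s (update s k (o.toList ++ s k)) 1 := by
  cases o with
  | none => exact (RunsIn.skip s).cast (by simp) le_rfl
  | some a => exact (RunsIn.push s k a).cast (by simp) le_rfl

/-- Push on `res` whether the binary number on `tmp₂` is odd, and whether it has one digit only. -/
def inspect : Cmd (Stk B) Γ' :=
  .pop tmp₂ fun o₁ => .pop tmp₂ fun o₂ => .seq (.push res (.bit (isOne o₁)))
    (.seq (.push res (.bit o₂.isNone)) (.seq (pushOption tmp₂ o₂) (pushOption tmp₂ o₁)))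

theorem runsIn_inspect (b : Bool) (bits : List Bool) (s : Stk B → List Γ')
    (h : s tmp₂ = (b :: bits).map Γ'.bit) :
    RunsIn inspect s (update s res (.bit bits.isEmpty :: .bit b :: s res)) 6 := by
  refine RunsIn.pop (T := 5) (o := some (.bit b)) (l := bits.map Γ'.bit) (by simp [h])
    (by simp [h]) (RunsIn.pop (T := 4) rfl rfl (((RunsIn.push _ _ _).seq ((RunsIn.push _ _ _).seq
      ((runsIn_pushOption _ _ _).seq (runsIn_pushOption _ _ _)))).cast ?_ le_rfl))
  cases bits <;>
  · funext x
    simp only [update_apply]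
    split_ifs <;> simp_all

/-- Costs of queries are polynomials in the order; monotonicity turns them into bounds in the length
of the input. -/
theorem eval_nat_mono (p : Polynomial ℕ) {m n : ℕ} (h : m ≤ n) : p.eval m ≤ p.eval n := by
  induction p using Polynomial.induction_on' with
  | add p q hp hq => simpa using add_le_add hp hq
  | monomial k a =>
    simpa using Nat.mul_le_mul_left a (Nat.pow_le_pow_left h k)

/-- Decide by the query `e₁` if the number is `1` or at least the order, and otherwise by the query
`e₂` if it is odd; accept in the remaining case. -/
def decideBy (e₁ e₂ : Query B) : Cmd (Stk B) Γ' :=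
  .seq parse (.seq inspect (.seq compareSize (.seq e₁.compile (.seq e₂.compile
    (.seq (.pop res fun o₂ => .pop res fun o₁ => .pop res fun g => .pop res fun u => .pop res fun d =>
      .push res (.bit (if isOne g || isOne u then isOne o₁ else !isOne d || isOne o₂)))
    (.seq (clear size) (clear mat)))))))

/-- Both queries are evaluated in every case, and the five bits on `res` are combined only
afterwards, so the costs simply add up. The matrix and the order are then erased, as
`exists_machine` wants nothing but the answer to be left. -/
theorem runsIn_decideBy (e₁ e₂ : Query B) (h₁ : e₁.Scoped []) (h₂ : e₂.Scoped []) (b : Bool)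
    (bits : List Bool) (rows : List (List Bool)) :
    RunsIn (decideBy e₁ e₂) (update (fun _ => []) inp (inputString (b :: bits) rows))
      (update (fun _ => []) res [.bit
        (if decide (rows.length ≤ binVal (b :: bits)) || bits.isEmpty then
          e₁.eval rows.length rows.flatten (fun _ => 0) (fun _ => [])
        else !b || e₂.eval rows.length rows.flatten (fun _ => 0) (fun _ => []))])
      ((Polynomial.X * (Polynomial.C 3 * Polynomial.X + Polynomial.C 25) + Polynomial.C 30 +
        e₁.cost + e₂.cost : Polynomial ℕ).eval (inputString (b :: bits) rows).length) := by
  set n := rows.length with hn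
  let S : List Γ' → Stk B → List Γ' := fun l =>
    update (update (update (fun _ : Stk B => []) size (List.replicate n one)) mat
      (rows.flatten.map Γ'.bit)) res l
  have hS : ∀ l a, update (S l) res (a :: S l res) = S (a :: l) := fun l a => by simp [S]
  have query : ∀ (e : Query B) (l : List Γ'), e.Scoped [] → RunsIn e.compile (S l)
      (S (.bit (e.eval n rows.flatten (fun _ => 0) fun _ => []) :: l)) (e.cost.eval n) := by
    intro e l he
    rw [← hS]
    exact e.runsIn_compile [] (fun _ => 0) (fun _ => []) (S l) he
      ⟨by simp [S], by simp [S], by simp [S], by simp [S], by simp [S], by simp [S], by simp [S],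
        by simp⟩ (fun b _ => by simp [S])
  have last : ∀ v₂ v₁ g u d : Bool, RunsIn (.pop res fun o₂ => .pop res fun o₁ => .pop res fun g =>
      .pop res fun u => .pop res fun d => .push res
        (.bit (if isOne g || isOne u then isOne o₁ else !isOne d || isOne o₂)))
      (S [.bit v₂, .bit v₁, .bit g, .bit u, .bit d])
      (S [.bit (if g || u then v₁ else !d || v₂)]) 6 := by
    intro v₂ v₁ g u d
    refine RunsIn.pop (T := 5) (o := some (.bit v₂)) rfl rfl (RunsIn.pop (T := 4)
      (o := some (.bit v₁)) rfl rfl (RunsIn.pop (T := 3) (o := some (.bit g)) rfl rfl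
      (RunsIn.pop (T := 2) (o := some (.bit u)) rfl rfl (RunsIn.pop (T := 1)
      (o := some (.bit d)) rfl rfl ((RunsIn.push _ _ _).cast ?_ le_rfl)))))
    simp [S]
  have init := (runsIn_parse (B := B) (b :: bits) rows).seq ((runsIn_inspect b bits _
    (by simp)).seq (((runsIn_compareSize (b :: bits) n _ (by simp) (by simp) (by simp)
      (by simp [hn])).cast (s₂ := S [.bit (decide (n ≤ binVal (b :: bits))), .bit bits.isEmpty,
        .bit b]) (by
          funext x
          simp only [S, update_apply]
          split_ifs <;> simp_all) le_rfl).seq ((query e₁ _ h₁).seq ((query e₂ _ h₂).seq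
            ((last _ _ _ _ _).seq ((runsIn_clear size _).seq (runsIn_clear mat _)))))))
  refine init.cast ?_ ?_
  · funext x
    simp only [S, update_apply]
    split_ifs <;> simp_all
  · set ℓ := (inputString (b :: bits) rows).length with hℓ
    have hlen : ℓ = bits.length + 2 + (rows.flatten.length + n) := by
      have : (rows.flatMap fun r => r.map Γ'.bit ++ [Γ'.comma]).length =
          rows.flatten.length + rows.length := by
        clear * -
        induction rows with
        | nil => simp
        | cons r rows ih => simp [List.flatMap_cons, ih]; omega
      simp only [hℓ, inputString, List.length_append, List.length_map, List.length_cons, this, hn]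
      omega
    have hn : n ≤ ℓ := by omega
    have m₁ : e₁.cost.eval n ≤ e₁.cost.eval ℓ := eval_nat_mono _ hn
    have m₂ : e₂.cost.eval n ≤ e₂.cost.eval ℓ := eval_nat_mono _ hn
    have m₃ : (bits.length + 1) * (3 * n + 10) ≤ ℓ * (3 * ℓ + 10) :=
      Nat.mul_le_mul (by omega) (by omega)
    simp only [S, update_apply, reduceCtorEq, if_true, if_false, List.length_cons,
      List.length_replicate, List.length_map, Polynomial.eval_add, Polynomial.eval_mul,
      Polynomial.eval_C, Polynomial.eval_X]
    have m₄ : ℓ * (3 * ℓ + 25) = ℓ * (3 * ℓ + 10) + 15 * ℓ := by ring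
    omega

end StackProg

/-! ### The span of the cliques on p vertices -/

namespace OrientedGraph

open Finset

section Clique

variable {V : Type*} [DecidableEq V]

/-- The indicator function of a set of vertices. -/
def ind (X : Finset V) (x : V) : ZMod 2 := if x ∈ X then 1 else 0

/-- The edge set of the complete graph on `X`, as a matrix over the field with two elements. -/
def clique (X : Finset V) (x y : V) : ZMod 2 := if x = y then 0 else ind X x * ind X y

/-- The edge `ab` as a matrix over the field with two elements. -/
def edge (a b x y : V) : ZMod 2 := ind {a} x * ind {b} y + ind {b} x * ind {a} y

theorem ind_insert {a : V} {X : Finset V} (h : a ∉ X) (x : V) :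
    ind (insert a X) x = ind X x + ind {a} x := by
  unfold ind
  by_cases hx : x = a
  · subst hx; simp [h]
  · simp [hx]

theorem ind_insert_insert {a b : V} {X : Finset V} (hab : a ≠ b) (ha : a ∉ X) (hb : b ∉ X)
    (x : V) : ind (insert a (insert b X)) x = ind X x + ind {b} x + ind {a} x := by
  rw [ind_insert (by simp [hab, ha]), ind_insert hb]

theorem ind_mul_ind_of_ne {a x y : V} (h : x ≠ y) : ind {a} x * ind {a} y = 0 := by
  unfold ind
  by_cases hx : x = a
  · subst hx; simp [h.symm]
  · simp [hx]

theorem edge_comm (a b : V) : edge a b = edge b a := by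
  funext x y
  unfold edge
  ring

theorem two_eq_zero : (2 : ZMod 2) = 0 := rfl

theorem edge_self (a b x : V) : edge a b x x = 0 := by
  unfold edge
  linear_combination (ind {a} x * ind {b} x) * two_eq_zero

theorem edge_symm (a b x y : V) : edge a b x y = edge a b y x := by
  unfold edge
  ring

theorem clique_self (X : Finset V) (x : V) : clique X x x = 0 := if_pos rfl

theorem clique_symm (X : Finset V) (x y : V) : clique X x y = clique X y x := by
  unfold clique
  rw [mul_comm]
  simp only [eq_comm]

theorem add_self_eq_zero' {V : Type*} (S : V → V → ZMod 2) : S + S = 0 := by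
  funext x y
  exact CharTwo.add_self_eq_zero (S x y)

theorem sum_edge [Fintype V] {a b : V} (x : V) :
    ∑ y, edge a b x y = ind {a} x + ind {b} x := by
  unfold edge
  rw [Finset.sum_add_distrib, ← Finset.mul_sum, ← Finset.mul_sum]
  simp [ind]

/-- The flips of edges generated by the complete graphs on `p` vertices. -/
def cliqueSpan (V : Type*) [DecidableEq V] (p : ℕ) : AddSubmonoid (V → V → ZMod 2) :=
  AddSubmonoid.closure {S | ∃ X : Finset V, X.card = p ∧ S = clique X}

theorem clique_mem_cliqueSpan {p : ℕ} {X : Finset V} (h : X.card = p) :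
    clique X ∈ cliqueSpan V p :=
  AddSubmonoid.subset_closure ⟨X, h, rfl⟩

theorem exists_disjoint_card [Fintype V] (A : Finset V) {k : ℕ} (h : A.card + k ≤ Fintype.card V) :
    ∃ Y : Finset V, Y.card = k ∧ Disjoint A Y := by
  obtain ⟨Y, hY, hk⟩ := Finset.exists_subset_card_eq (s := Aᶜ) (n := k)
    (by rw [Finset.card_compl]; omega)
  exact ⟨Y, hk, disjoint_compl_right.mono_right hY⟩

/-- Choose p - 2 vertices Y off the square and add the cliques on Y together with each side. Pairs
inside Y occur four times and pairs between a corner and Y twice, so only the sides remain. The room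
for Y is where n ≥ p + 2 is needed. -/
theorem square_mem_cliqueSpan [Fintype V] {p : ℕ} (hp : 2 ≤ p) (hV : p + 2 ≤ Fintype.card V)
    {a b c d : V} (hab : a ≠ b) (had : a ≠ d) (hbc : b ≠ c) (hcd : c ≠ d) : edge a b + edge b c + edge c d + edge d a ∈ cliqueSpan V p := by
  obtain ⟨Y, hY, hdisj⟩ := exists_disjoint_card {a, b, c, d} (k := p - 2)
    (by have := Finset.card_le_four (a := a) (b := b) (c := c) (d := d); omega)
  simp only [disjoint_insert_left, disjoint_singleton_left] at hdisj
  obtain ⟨ha, hb, hc, hd⟩ := hdisj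
  have hmem : ∀ {u v : V}, u ≠ v → u ∉ Y → v ∉ Y →
      clique (insert u (insert v Y)) ∈ cliqueSpan V p := by
    intro u v huv hu hv
    refine clique_mem_cliqueSpan ?_
    rw [card_insert_of_notMem (by simp [huv, hu]), card_insert_of_notMem hv]
    omega
  have key : edge a b + edge b c + edge c d + edge d a =
      clique (insert a (insert b Y)) + clique (insert b (insert c Y)) +
        clique (insert c (insert d Y)) + clique (insert d (insert a Y)) := by
    funext x y
    simp only [Pi.add_apply]
    by_cases hxy : x = y
    · subst hxy
      simp [edge_self, clique_self]
    · simp only [clique, if_neg hxy]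
      simp only [ind_insert_insert hab ha hb, ind_insert_insert hbc hb hc,
        ind_insert_insert hcd hc hd, ind_insert_insert had.symm hd ha]
      unfold edge
      linear_combination (-(2 * ind Y x * ind Y y) -
        ind Y x * (ind {a} y + ind {b} y + ind {c} y + ind {d} y) -
        ind Y y * (ind {a} x + ind {b} x + ind {c} x + ind {d} x) -
        (ind {a} x * ind {a} y + ind {b} x * ind {b} y + ind {c} x * ind {c} y +
          ind {d} x * ind {d} y)) * two_eq_zero
  rw [key]
  exact add_mem (add_mem (add_mem (hmem hab ha hb) (hmem hbc hb hc)) (hmem hcd hc hd))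
    (hmem had.symm hd ha)

/-- The cliques on Z ∪ {a, b} and Z ∪ {c, b} with |Z| = p - 2 sum to the path abc plus all edges
from a and c to Z. Adding the squares a, b, c, z for z in Z cancels the latter, and contributes the
path p - 2 times, hence nothing for even p. -/
theorem path_mem_cliqueSpan [Fintype V] {p : ℕ} (hp : 2 ≤ p) (hV : p + 2 ≤ Fintype.card V)
    (heven : Even p) {a b c : V} (hab : a ≠ b) (hbc : b ≠ c) :
    edge a b + edge b c ∈ cliqueSpan V p := by
  obtain ⟨Z, hZ, hdisj⟩ := exists_disjoint_card {a, b, c} (k := p - 2)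
    (by have := Finset.card_le_three (a := a) (b := b) (c := c); omega)
  simp only [disjoint_insert_left, disjoint_singleton_left] at hdisj
  obtain ⟨ha, hb, hc⟩ := hdisj
  have key : clique (insert a (insert b Z)) + clique (insert c (insert b Z)) +
      ∑ z ∈ Z, (edge a b + edge b c + edge c z + edge z a) = edge a b + edge b c := by
    have hsum : ∑ z ∈ Z, (edge a b + edge b c + edge c z + edge z a) =
        fun x y => ind Z x * (ind {a} y + ind {c} y) + ind Z y * (ind {a} x + ind {c} x) := by
      have hcard : ((Z.card : ℕ) : V → V → ZMod 2) = 0 := by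
        have : ((Z.card : ℕ) : ZMod 2) = 0 := by
          rw [ZMod.natCast_eq_zero_iff, hZ]
          obtain ⟨k, rfl⟩ := heven
          exact ⟨k - 1, by omega⟩
        funext x y
        exact this
      have : ∀ z, edge a b + edge b c + edge c z + edge z a =
          (edge a b + edge b c) + (edge c z + edge z a) := fun z => add_assoc _ _ _
      simp only [this]
      rw [Finset.sum_add_distrib, Finset.sum_const, nsmul_eq_mul, hcard, zero_mul, zero_add]
      funext x y
      have hZ' : ∀ x, ∑ z ∈ Z, ind {z} x = ind Z x := by intro x; simp [ind]
      simp only [Finset.sum_apply, Pi.add_apply, edge]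
      simp only [Finset.sum_add_distrib, ← Finset.mul_sum, ← Finset.sum_mul, hZ']
      ring
    rw [hsum]
    funext x y
    simp only [Pi.add_apply]
    by_cases hxy : x = y
    · subst hxy
      simp only [edge_self, clique_self]
      linear_combination (ind Z x * (ind {a} x + ind {c} x)) * two_eq_zero
    · simp only [clique, if_neg hxy]
      simp only [ind_insert_insert hab ha hb, ind_insert_insert hbc.symm hc hb]
      unfold edge
      linear_combination (ind Z x * ind Z y + ind Z x * (ind {a} y + ind {b} y + ind {c} y) +
        ind Z y * (ind {a} x + ind {b} x + ind {c} x) + ind {b} x * ind {b} y) * two_eq_zero +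
        ind_mul_ind_of_ne (a := a) hxy + ind_mul_ind_of_ne (a := c) hxy
  rw [← key]
  refine add_mem (add_mem (clique_mem_cliqueSpan ?_) (clique_mem_cliqueSpan ?_))
    (sum_mem fun z hz => square_mem_cliqueSpan hp hV hab ?_ hbc ?_)
  · rw [card_insert_of_notMem (by simp [hab, ha]), card_insert_of_notMem hb]; omega
  · rw [card_insert_of_notMem (by simp [hbc.symm, hc]), card_insert_of_notMem hb]; omega
  · rintro rfl; exact ha hz
  · rintro rfl; exact hc hz

/-- The triangle `abc` as a matrix over the field with two elements. -/
def triangle (a b c : V) : V → V → ZMod 2 := edge a b + edge b c + edge c a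

/-- Two triangles with a common edge sum to a square. Triangles with a common vertex a are linked by
such steps, from abc to adc to ade. -/
theorem triangle_add_triangle_mem [Fintype V] {p : ℕ} (hp : 2 ≤ p) (hV : p + 2 ≤ Fintype.card V)
    {a b c d e : V} (hab : a ≠ b) (hac : a ≠ c) (hbc : b ≠ c) (had : a ≠ d) (hae : a ≠ e)
    (hde : d ≠ e) : triangle a b c + triangle a d e ∈ cliqueSpan V p := by
  have key : ∀ {b c d : V}, a ≠ b → a ≠ d → b ≠ c → d ≠ c →
      triangle a b c + triangle a d c ∈ cliqueSpan V p := by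
    intro b c d hab had hbc hdc
    have : triangle a b c + triangle a d c = edge a b + edge b c + edge c d + edge d a := by
      unfold triangle
      rw [edge_comm c d, edge_comm d a]
      linear_combination (exp := 1) add_self_eq_zero' (edge c a)
    rw [this]
    exact square_mem_cliqueSpan hp hV hab had hbc hdc.symm
  have swap : ∀ b c : V, triangle a b c = triangle a c b := by
    intro b c
    unfold triangle
    rw [edge_comm a b, edge_comm b c, edge_comm c a]
    abel
  have trans : ∀ {S T U : V → V → ZMod 2}, S + T ∈ cliqueSpan V p → T + U ∈ cliqueSpan V p →
      S + U ∈ cliqueSpan V p := by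
    intro S T U h h'
    have := add_mem h h'
    have e : S + T + (T + U) = S + U + (T + T) := by abel
    rwa [e, add_self_eq_zero', add_zero] at this
  by_cases hcd : c = d
  · subst hcd
    rw [swap c e]
    exact key hab hae hbc hde.symm
  · refine trans (key hab had hbc (Ne.symm hcd)) ?_
    rw [swap d c, swap d e]
    exact key hac hae hcd hde.symm

theorem edge_add_edge_mem [Fintype V] {p : ℕ} (hp : 2 ≤ p) (hV : p + 2 ≤ Fintype.card V)
    (heven : Even p) {a b c d : V} (hab : a ≠ b) (hcd : c ≠ d) :
    edge a b + edge c d ∈ cliqueSpan V p := by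
  by_cases hbc : b = c
  · subst hbc
    exact path_mem_cliqueSpan hp hV heven hab hcd
  · have e : edge a b + edge c d =
        (edge a b + edge b c) + (edge b c + edge c d) + (edge b c + edge b c) -
          (edge b c + edge b c) - (edge b c + edge b c) := by abel
    rw [e, add_self_eq_zero', add_zero, sub_zero, sub_zero]
    exact add_mem (path_mem_cliqueSpan hp hV heven hab hbc)
      (path_mem_cliqueSpan hp hV heven hbc hcd)

end Clique

/-- If all generators are congruent to `T` modulo `W`, then so is every nonzero class. -/
theorem mem_or_add_mem {V : Type*} {W : AddSubmonoid (V → V → ZMod 2)} {G : Set (V → V → ZMod 2)}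
    {S T : V → V → ZMod 2} (hG : ∀ g ∈ G, g + T ∈ W) (hS : S ∈ AddSubmonoid.closure G) :
    S ∈ W ∨ S + T ∈ W := by
  induction hS using AddSubmonoid.closure_induction with
  | mem g hg => exact Or.inr (hG g hg)
  | zero => exact Or.inl (zero_mem W)
  | add S S' _ _ h h' =>
    rcases h with h | h <;> rcases h' with h' | h'
    · exact Or.inl (add_mem h h')
    · right
      rw [add_assoc]
      exact add_mem h h'
    · right
      rw [add_right_comm]
      exact add_mem h h'
    · left
      have := add_mem h h'
      have e : S + T + (S' + T) = S + S' + (T + T) := by abel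
      rwa [e, add_self_eq_zero', add_zero] at this

section Generators

theorem smul_mem_closure {V : Type*} {G : Set (V → V → ZMod 2)} (c : ZMod 2) {S : V → V → ZMod 2}
    (h : S ∈ AddSubmonoid.closure G) : c • S ∈ AddSubmonoid.closure G := by
  have hc : c = 0 ∨ c = 1 := by revert c; decide
  rcases hc with rfl | rfl
  · simp
  · simpa using h

variable {V : Type*} [Fintype V] [LinearOrder V]

/-- The condition `u < v` counts each unordered pair once. The predicate `P` serves to restrict to
edges that avoid a given vertex. -/
theorem sum_edge_smul (S : V → V → ZMod 2) (hsymm : ∀ x y, S x y = S y x) (P : V → V → Prop)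
    [∀ u v, Decidable (P u v)] (hP : ∀ u v, P u v ↔ P v u) {x y : V} (hxy : x ≠ y) :
    (∑ u, ∑ v, (if u < v ∧ P u v then S u v else 0) • edge u v) x y =
      if P x y then S x y else 0 := by
  simp only [Finset.sum_apply, Pi.smul_apply, smul_eq_mul, edge, ind, Finset.mem_singleton,
    mul_add, Finset.sum_add_distrib]
  have e₁ : ∀ u v : V, (if u < v ∧ P u v then S u v else 0) *
      ((if x = u then 1 else 0) * (if y = v then 1 else 0)) =
        if y = v then (if x = u then (if u < v ∧ P u v then S u v else 0) else 0) else 0 := by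
    intro u v
    split_ifs <;> simp
  have e₂ : ∀ u v : V, (if u < v ∧ P u v then S u v else 0) *
      ((if x = v then 1 else 0) * (if y = u then 1 else 0)) =
        if x = v then (if y = u then (if u < v ∧ P u v then S u v else 0) else 0) else 0 := by
    intro u v
    split_ifs <;> simp
  simp only [e₁, e₂, Finset.sum_ite_eq, Finset.mem_univ, if_true]
  simp only [hP y x, hsymm y x]
  rcases lt_or_gt_of_ne hxy with h | h
  · simp [h, h.not_gt]
  · simp [h, h.not_gt]

theorem mem_closure_edge (S : V → V → ZMod 2) (hsymm : ∀ x y, S x y = S y x)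
    (hdiag : ∀ x, S x x = 0) :
    S ∈ AddSubmonoid.closure {T | ∃ u v : V, u ≠ v ∧ T = edge u v} := by
  have key : S = ∑ u, ∑ v, (if u < v ∧ True then S u v else 0) • edge u v := by
    funext x y
    by_cases hxy : x = y
    · subst hxy
      rw [hdiag]
      simp only [Finset.sum_apply, Pi.smul_apply, edge_self, smul_zero, Finset.sum_const_zero]
    · rw [sum_edge_smul S hsymm (fun _ _ => True) (by simp) hxy, if_pos trivial]
  rw [key]
  refine sum_mem fun u _ => sum_mem fun v _ => ?_
  split_ifs with h
  · exact smul_mem_closure _ (AddSubmonoid.subset_closure ⟨u, v, h.1.ne, rfl⟩)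
  · simp

/-- Add the triangles joining `a` to the edges of S that avoid `a`. The sum agrees with S off `a`,
and it also agrees at `a`, since rows with zero sum determine the last entry. -/
theorem mem_closure_triangle (a : V) (S : V → V → ZMod 2) (hsymm : ∀ x y, S x y = S y x)
    (hdiag : ∀ x, S x x = 0) (hsum : ∀ x, ∑ y, S x y = 0) :
    S ∈ AddSubmonoid.closure
      {T | ∃ u v : V, u ≠ v ∧ a ≠ u ∧ a ≠ v ∧ T = triangle a u v} := by
  set P : V → V → ZMod 2 :=
    ∑ u, ∑ v, (if u < v ∧ (u ≠ a ∧ v ≠ a) then S u v else 0) • triangle a u v with hPdef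
  have hP : P ∈ AddSubmonoid.closure
      {T | ∃ u v : V, u ≠ v ∧ a ≠ u ∧ a ≠ v ∧ T = triangle a u v} := by
    refine sum_mem fun u _ => sum_mem fun v _ => ?_
    split_ifs with h
    · exact smul_mem_closure _
        (AddSubmonoid.subset_closure ⟨u, v, h.1.ne, h.2.1.symm, h.2.2.symm, rfl⟩)
    · simp
  have hPsymm : ∀ x y, P x y = P y x := by
    intro x y
    simp only [hPdef, Finset.sum_apply, Pi.smul_apply, triangle, Pi.add_apply, edge_symm _ _ x y]
  have hPsum : ∀ x, ∑ y, P x y = 0 := by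
    intro x
    simp only [hPdef, Finset.sum_apply, Pi.smul_apply, triangle, Pi.add_apply, smul_eq_mul]
    rw [Finset.sum_comm]
    refine Finset.sum_eq_zero fun u _ => ?_
    rw [Finset.sum_comm]
    refine Finset.sum_eq_zero fun v _ => ?_
    rw [← Finset.mul_sum, Finset.sum_add_distrib, Finset.sum_add_distrib, sum_edge, sum_edge,
      sum_edge]
    linear_combination ((if u < v ∧ (u ≠ a ∧ v ≠ a) then S u v else 0) *
      (ind {a} x + ind {u} x + ind {v} x)) * two_eq_zero
  have hPdiag : ∀ x, P x x = 0 := by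
    intro x
    simp only [hPdef, Finset.sum_apply, Pi.smul_apply, triangle, Pi.add_apply, edge_self, add_zero,
      smul_zero, Finset.sum_const_zero]
  have hne : ∀ x y, x ≠ a → y ≠ a → P x y = S x y := by
    intro x y hx hy
    by_cases hxy : x = y
    · subst hxy
      rw [hPdiag, hdiag]
    · have := sum_edge_smul S hsymm (fun u v => u ≠ a ∧ v ≠ a) (fun u v => and_comm) hxy
      rw [if_pos ⟨hx, hy⟩] at this
      rw [← this]
      simp only [hPdef, Finset.sum_apply, Pi.smul_apply, triangle, Pi.add_apply]
      refine Finset.sum_congr rfl fun u _ => Finset.sum_congr rfl fun v _ => ?_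
      have e₁ : edge a u x y = 0 := by simp [edge, ind, hx, hy]
      have e₂ : edge v a x y = 0 := by simp [edge, ind, hx, hy]
      rw [e₁, e₂, zero_add, add_zero]
  have hcol : ∀ x, x ≠ a → P x a = S x a := by
    intro x hx
    have h₁ := hPsum x
    have h₂ := hsum x
    rw [← Finset.add_sum_erase _ _ (Finset.mem_univ a)] at h₁ h₂
    rw [← h₂, Finset.sum_congr rfl fun y hy => hne x y hx (Finset.ne_of_mem_erase hy)] at h₁
    exact add_right_cancel h₁
  have : S = P := by
    funext x y
    by_cases hx : x = a
    · by_cases hy : y = a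
      · rw [hx, hy, hdiag, hPdiag]
      · rw [hx, hsymm, hPsymm, hcol y hy]
    · by_cases hy : y = a
      · rw [hy, hcol x hx]
      · exact (hne x y hx hy).symm
  rw [this]
  exact hP

end Generators

end OrientedGraph

/-! ### Flips of arcs and linear orders -/

namespace OrientedGraph

open Finset

section Flip

variable {V : Type*}

/-- The adjacency relation obtained from `D` by reversing the arcs in `S`. -/
def FlipAdj (D : OrientedGraph V) (S : V → V → ZMod 2) (u v : V) : Prop :=
  (S u v = 0 ∧ D.Adj u v) ∨ (S u v = 1 ∧ D.Adj v u)

theorem zmod_two_cases (x : ZMod 2) : x = 0 ∨ x = 1 := by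
  revert x; decide

theorem invert_flipAdj [DecidableEq V] (D : OrientedGraph V) (X : Finset V)
    (S : V → V → ZMod 2) : (D.invert X).FlipAdj S = D.FlipAdj (clique X + S) := by
  funext u v
  have h₁ := D.asymm u v
  have two : (1 : ZMod 2) + 1 = 0 := rfl
  by_cases huv : u = v
  · subst huv
    have : ¬ D.Adj u u := fun h => D.asymm u u h h
    simp [FlipAdj, invert, this]
  · rcases zmod_two_cases (S u v) with h | h <;> by_cases hu : u ∈ X <;> by_cases hv : v ∈ X <;>
      simp [FlipAdj, invert, clique, ind, h, hu, hv, huv, two]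

theorem invertFamily_adj [DecidableEq V] (D : OrientedGraph V) (F : List (Finset V)) :
    (D.invertFamily F).Adj = D.FlipAdj (F.map clique).sum := by
  induction F generalizing D with
  | nil =>
    funext u v
    simp [invertFamily, FlipAdj]
  | cons X F ih =>
    have : D.invertFamily (X :: F) = (D.invert X).invertFamily F := rfl
    rw [this, ih, invert_flipAdj, List.map_cons, List.sum_cons]

/-- The flips caused by successive inversions add up modulo 2, so a family matters only through the
sum of its cliques. -/
theorem isEqInvertible_iff [DecidableEq V] {p : ℕ} {D : OrientedGraph V} :
    D.IsEqInvertible p ↔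
      ∃ S ∈ cliqueSpan V p, ∀ v, ¬ Relation.TransGen (D.FlipAdj S) v v := by
  constructor
  · rintro ⟨F, hF, h⟩
    refine ⟨(F.map clique).sum, list_sum_mem ?_, ?_⟩
    · intro S hS
      obtain ⟨X, hX, rfl⟩ := List.mem_map.mp hS
      exact clique_mem_cliqueSpan (hF X hX)
    · rwa [← invertFamily_adj]
  · rintro ⟨S, hS, h⟩
    obtain ⟨l, hl, rfl⟩ := AddSubmonoid.exists_list_of_mem_closure hS
    have : ∃ F : List (Finset V), (∀ X ∈ F, X.card = p) ∧ F.map clique = l := by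
      clear h hS
      induction l with
      | nil => exact ⟨[], by simp, rfl⟩
      | cons T l ih =>
        obtain ⟨X, hX, rfl⟩ := hl T (by simp)
        obtain ⟨F, hF, rfl⟩ := ih fun T hT => hl T (by simp [hT])
        exact ⟨X :: F, by simpa [hX] using hF, rfl⟩
    obtain ⟨F, hF, rfl⟩ := this
    refine ⟨F, hF, ?_⟩
    unfold IsAcyclic
    rwa [invertFamily_adj]

theorem acyclic_of_order {R : V → V → Prop} (σ : V → ℕ) (h : ∀ u v, R u v → σ v < σ u) (v : V) :
    ¬ Relation.TransGen R v v := by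
  intro hv
  have : ∀ u w, Relation.TransGen R u w → σ w < σ u := by
    intro u w huw
    induction huw with
    | single h' => exact h _ _ h'
    | tail _ h' ih => exact (h _ _ h').trans ih
  exact lt_irrefl _ (this v v hv)

/-- Reachability in an acyclic relation is a partial order, which extends to a linear one. Arcs go
from later to earlier positions, a convention kept below. -/
theorem exists_order_of_acyclic [Fintype V] {R : V → V → Prop}
    (h : ∀ v, ¬ Relation.TransGen R v v) :
    ∃ σ : V ≃ Fin (Fintype.card V), ∀ u v, R u v → σ v < σ u := by
  classical
  let r : V → V → Prop := fun u v => Relation.ReflTransGen R v u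
  have : IsPartialOrder V r :=
    { refl := fun _ => Relation.ReflTransGen.refl
      trans := fun _ _ _ h₁ h₂ => h₂.trans h₁
      antisymm := by
        intro u v h₁ h₂
        by_contra huv
        rcases Relation.reflTransGen_iff_eq_or_transGen.mp h₁ with h₁ | h₁
        · exact huv h₁
        · exact h v (h₁.trans_left h₂) }
  obtain ⟨s, hs, hrs⟩ := extend_partialOrder r
  let : LinearOrder V :=
    { le := s
      le_refl := hs.refl
      le_trans := hs.trans
      le_antisymm := hs.antisymm
      le_total := hs.total
      toDecidableLE := Classical.decRel _ }
  let e := (Fintype.orderIsoFinOfCardEq V rfl).symm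
  refine ⟨e.toEquiv, fun u v huv => ?_⟩
  have hle : v ≤ u := hrs v u (Relation.ReflTransGen.single huv)
  have hne : v ≠ u := by
    rintro rfl
    exact h v (Relation.TransGen.single huv)
  exact e.lt_iff_lt.mpr (lt_of_le_of_ne hle hne)

/-- Allows a correction of S by T at the price of changing the order: `σ'` must reverse the pairs in
T and keep all others. -/
theorem flipAdj_add {D : OrientedGraph V} {S T : V → V → ZMod 2} {σ σ' : V → ℕ}
    (hS : ∀ u v, S u v = S v u) (hT : ∀ u v, T u v = T v u)
    (h : ∀ u v, D.FlipAdj S u v → σ v < σ u)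
    (h₀ : ∀ u v, σ v < σ u → T u v = 0 → σ' v < σ' u)
    (h₁ : ∀ u v, σ v < σ u → T u v = 1 → σ' u < σ' v) (u v : V)
    (huv : D.FlipAdj (S + T) u v) : σ' v < σ' u := by
  have two : (1 : ZMod 2) + 1 = 0 := rfl
  rcases zmod_two_cases (T u v) with ht | ht
  · refine h₀ u v (h u v ?_) ht
    simpa [FlipAdj, ht] using huv
  · refine h₁ v u (h v u ?_) (by rw [hT, ht])
    rcases zmod_two_cases (S u v) with hs | hs
    · simpa [FlipAdj, ht, hs, hS v u] using huv
    · simpa [FlipAdj, ht, hs, hS v u, two] using huv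

theorem cliqueSpan_symm [DecidableEq V] {p : ℕ} {S : V → V → ZMod 2} (hS : S ∈ cliqueSpan V p)
    (u v : V) : S u v = S v u := by
  induction hS using AddSubmonoid.closure_induction with
  | mem S h => obtain ⟨X, -, rfl⟩ := h; exact clique_symm X u v
  | zero => rfl
  | add S T _ _ h h' => simp [h, h']

theorem cliqueSpan_self [DecidableEq V] {p : ℕ} {S : V → V → ZMod 2} (hS : S ∈ cliqueSpan V p)
    (u : V) : S u u = 0 := by
  induction hS using AddSubmonoid.closure_induction with
  | mem S h => obtain ⟨X, -, rfl⟩ := h; exact clique_self X u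
  | zero => rfl
  | add S T _ _ h h' => simp [h, h']

/-- A vertex of X has degree `X.card - 1` in the clique, which is even; the other vertices have
degree zero. -/
theorem sum_clique [Fintype V] [DecidableEq V] {X : Finset V} (hX : Odd X.card) (u : V) :
    ∑ v, clique X u v = 0 := by
  have : ∀ v, clique X u v = ind X u * ind X v - if u = v then ind X u else 0 := by
    intro v
    unfold clique ind
    split_ifs <;> simp_all
  simp only [this, Finset.sum_sub_distrib, ← Finset.mul_sum]
  have hc : ∑ v, ind X v = 1 := by
    unfold ind
    rw [Finset.sum_boole]
    simpa using (ZMod.natCast_eq_one_iff_odd).mpr hX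
  simp [hc]

theorem cliqueSpan_sum [Fintype V] [DecidableEq V] {p : ℕ} (hp : Odd p) {S : V → V → ZMod 2}
    (hS : S ∈ cliqueSpan V p) (u : V) : ∑ v, S u v = 0 := by
  induction hS using AddSubmonoid.closure_induction with
  | mem S h => obtain ⟨X, hX, rfl⟩ := h; exact sum_clique (hX ▸ hp) u
  | zero => simp
  | add S T _ _ h h' => simp [Finset.sum_add_distrib, h, h']

open scoped Classical in
/-- The arcs of `D` that do not go from a later to an earlier vertex of the order `σ`. -/
noncomputable def mismatch (D : OrientedGraph V) (σ : V → ℕ) (u v : V) : ZMod 2 :=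
  if (D.Adj u v ∧ σ u < σ v) ∨ (D.Adj v u ∧ σ v < σ u) then 1 else 0

theorem mismatch_symm (D : OrientedGraph V) (σ : V → ℕ) (u v : V) :
    D.mismatch σ u v = D.mismatch σ v u := by
  unfold mismatch
  split_ifs <;> tauto

theorem mismatch_self (D : OrientedGraph V) (σ : V → ℕ) (u : V) : D.mismatch σ u u = 0 := by
  simp [mismatch]

theorem not_adj_self (D : OrientedGraph V) (u : V) : ¬ D.Adj u u := fun h => D.asymm u u h h

theorem flipAdj_mismatch {D : OrientedGraph V} {σ : V → ℕ} (hσ : Function.Injective σ) {u v : V}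
    (h : D.FlipAdj (D.mismatch σ) u v) : σ v < σ u := by
  have hne : u ≠ v := by
    rintro rfl
    rcases h with ⟨-, h⟩ | ⟨-, h⟩ <;> exact D.not_adj_self u h
  have hne' : σ u ≠ σ v := fun h => hne (hσ h)
  have h₁ := D.asymm u v
  unfold FlipAdj mismatch at h
  split_ifs at h with hc
  · simp at h
    have := D.asymm v u h
    tauto
  · simp at h
    by_contra hlt
    exact hc (Or.inl ⟨h, by omega⟩)

end Flip

variable {V : Type*} [Fintype V] [LinearOrder V]

/-- All edges are congruent modulo the span, so the mismatch of an arbitrary order is in the span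
either itself or after adding the edge between the two first vertices. -/
theorem isEqInvertible_of_even {p : ℕ} (hp : 2 ≤ p) (heven : Even p)
    (hV : p + 2 ≤ Fintype.card V) (D : OrientedGraph V) : D.IsEqInvertible p := by
  rw [isEqInvertible_iff]
  let e := Fintype.equivFin V
  let σ : V → ℕ := fun v => e v
  have hσ : Function.Injective σ := fun u v h => e.injective (Fin.ext h)
  let c := e.symm ⟨0, by omega⟩
  let d := e.symm ⟨1, by omega⟩
  have hc : ∀ v, v = c ↔ σ v = 0 := fun v => by
    rw [← e.apply_eq_iff_eq, Equiv.apply_symm_apply, Fin.ext_iff]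
  have hd : ∀ v, v = d ↔ σ v = 1 := fun v => by
    rw [← e.apply_eq_iff_eq, Equiv.apply_symm_apply, Fin.ext_iff]
  have hcd : c ≠ d := fun h => by simpa using ((hc c).mp rfl).symm.trans ((hd c).mp h)
  rcases mem_or_add_mem (W := cliqueSpan V p) (T := edge c d)
    (by rintro _ ⟨u, v, huv, rfl⟩; exact edge_add_edge_mem hp hV heven huv hcd)
    (mem_closure_edge (D.mismatch σ) (D.mismatch_symm σ) (D.mismatch_self σ)) with h | h
  · exact ⟨_, h, acyclic_of_order σ fun u v => flipAdj_mismatch hσ⟩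
  -- Exchanging positions 0 and 1 alters the relative order of `c` and `d` only.
  · refine ⟨_, h, acyclic_of_order (fun v => if σ v = 0 then 1 else if σ v = 1 then 0 else σ v)
      (flipAdj_add (σ := σ) (D.mismatch_symm σ) (edge_symm c d) (fun u v => flipAdj_mismatch hσ)
        ?_ ?_)⟩
    · intro u v huv hT
      simp only [edge, ind, Finset.mem_singleton, hc, hd] at hT
      split_ifs at hT ⊢ <;> first | omega | simp at hT
    · intro u v huv hT
      simp only [edge, ind, Finset.mem_singleton, hc, hd] at hT
      split_ifs at hT ⊢ <;> first | omega | simp at hT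

/-- Cliques of odd size have even degrees, hence so has the whole span. Conversely an even graph is
a sum of triangles at `a`, all congruent modulo the span, so at most the triangle on the first three
vertices has to be added. -/
theorem isEqInvertible_iff_of_odd {p : ℕ} (hp : 3 ≤ p) (hodd : Odd p)
    (hV : p + 2 ≤ Fintype.card V) (D : OrientedGraph V) :
    D.IsEqInvertible p ↔ ∃ S : V → V → ZMod 2, (∀ u v, S u v = S v u) ∧ (∀ u, S u u = 0) ∧
      (∀ u, ∑ v, S u v = 0) ∧ ∃ σ : V ≃ Fin (Fintype.card V),
        ∀ u v, D.FlipAdj S u v → σ v < σ u := by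
  rw [isEqInvertible_iff]
  constructor
  · rintro ⟨S, hS, h⟩
    exact ⟨S, cliqueSpan_symm hS, cliqueSpan_self hS, cliqueSpan_sum hodd hS,
      exists_order_of_acyclic h⟩
  · rintro ⟨S, hsymm, hdiag, hsum, e, he⟩
    let σ : V → ℕ := fun v => e v
    have hσ : ∀ u v, D.FlipAdj S u v → σ v < σ u := fun u v h => he u v h
    let a := e.symm ⟨0, by omega⟩
    let b := e.symm ⟨1, by omega⟩
    let c := e.symm ⟨2, by omega⟩
    have ha : ∀ v, v = a ↔ σ v = 0 := fun v => by
      rw [← e.apply_eq_iff_eq, Equiv.apply_symm_apply, Fin.ext_iff]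
    have hb : ∀ v, v = b ↔ σ v = 1 := fun v => by
      rw [← e.apply_eq_iff_eq, Equiv.apply_symm_apply, Fin.ext_iff]
    have hc : ∀ v, v = c ↔ σ v = 2 := fun v => by
      rw [← e.apply_eq_iff_eq, Equiv.apply_symm_apply, Fin.ext_iff]
    have hab : a ≠ b := fun h => by simpa using ((ha a).mp rfl).symm.trans ((hb a).mp h)
    have hac : a ≠ c := fun h => by simpa using ((ha a).mp rfl).symm.trans ((hc a).mp h)
    have hbc : b ≠ c := fun h => by simpa using ((hb b).mp rfl).symm.trans ((hc b).mp h)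
    rcases mem_or_add_mem (W := cliqueSpan V p) (T := triangle a b c)
      (by
        rintro _ ⟨u, v, huv, hu, hv, rfl⟩
        exact triangle_add_triangle_mem (by omega) hV hu hv huv hab hac hbc)
      (mem_closure_triangle a S hsymm hdiag hsum) with h | h
    · exact ⟨_, h, acyclic_of_order σ hσ⟩
    -- Exchanging positions 0 and 2 reverses exactly the three pairs among `a`, `b`, `c`.
    · refine ⟨_, h, acyclic_of_order (fun v => if σ v = 0 then 2 else if σ v = 2 then 0 else σ v)
        (flipAdj_add (σ := σ) hsymm
          (fun u v => by simp only [triangle, Pi.add_apply, edge_symm _ _ u v]) hσ ?_ ?_)⟩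
      · intro u v huv hT
        simp only [triangle, Pi.add_apply, edge, ind, Finset.mem_singleton, ha, hb, hc] at hT
        split_ifs at hT ⊢ <;> first | omega | simp at hT
      · intro u v huv hT
        simp only [triangle, Pi.add_apply, edge, ind, Finset.mem_singleton, ha, hb, hc] at hT
        split_ifs at hT ⊢ <;> first | omega | simp at hT

end OrientedGraph

/-! ### Parity conditions, odd positions and joins -/

namespace OrientedGraph

open Finset

section Parity

/-- The handshake lemma modulo 2: off-diagonal entries cancel with their transposes. -/
theorem sum_sum_eq_zero {V : Type*} (A : Finset V) (S : V → V → ZMod 2)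
    (hsymm : ∀ u ∈ A, ∀ v ∈ A, S u v = S v u) (hdiag : ∀ u ∈ A, S u u = 0) :
    ∑ u ∈ A, ∑ v ∈ A, S u v = 0 := by
  rw [← Finset.sum_product']
  refine Finset.sum_involution (fun x _ => (x.2, x.1)) ?_ ?_ ?_ ?_
  · intro x hx
    rw [Finset.mem_product] at hx
    rw [hsymm x.1 hx.1 x.2 hx.2]
    exact CharTwo.add_self_eq_zero _
  · rintro ⟨u, v⟩ hx hne h
    rw [Finset.mem_product] at hx
    simp only [Prod.mk.injEq] at h
    obtain ⟨rfl, -⟩ := h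
    exact hne (hdiag _ hx.1)
  · intro x hx
    rw [Finset.mem_product] at hx ⊢
    exact hx.symm
  · intro x _
    rfl

theorem sum_lt_eq {V : Type*} [Fintype V] (σ : V ≃ Fin (Fintype.card V)) (u : V) :
    ∑ v, (if (σ v : ℕ) < σ u then 1 else 0 : ZMod 2) = ((σ u : ℕ) : ZMod 2) := by
  rw [Finset.sum_boole]
  congr 1
  refine Eq.trans ?_ (Fin.card_Iio (σ u))
  rw [← Finset.card_map σ.toEmbedding]
  congr 1
  ext i
  simp only [mem_map_equiv, mem_filter, mem_univ, true_and, Equiv.apply_symm_apply, mem_Iio,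
    Fin.lt_def]

theorem card_eq_sum_fiber {V ι : Type*} [Fintype ι] [DecidableEq ι] (κ : V → ι) (O : Finset V) :
    O.card = ∑ r, (O.filter fun u => κ u = r).card :=
  Finset.card_eq_sum_card_fiberwise fun _ _ => Finset.mem_univ _

variable {V ι : Type*} [Fintype ι] [DecidableEq ι]

/-- A fiber in which an odd number of elements is required must contain at least one. -/
theorem card_odd_le (κ : V → ι) (a : ι → ZMod 2) {O : Finset V}
    (hO : ∀ r, ((O.filter fun u => κ u = r).card : ZMod 2) = a r) :
    (univ.filter fun r => a r = 1).card ≤ O.card := by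
  rw [card_eq_sum_fiber κ O, Finset.card_filter]
  refine Finset.sum_le_sum fun r _ => ?_
  split_ifs with h
  · by_contra hlt
    have : (O.filter fun u => κ u = r).card = 0 := by omega
    have h' := hO r
    rw [this, h] at h'
    exact absurd h' (by decide)
  · exact Nat.zero_le _

theorem natCast_card_eq (κ : V → ι) (a : ι → ZMod 2) {O : Finset V}
    (hO : ∀ r, ((O.filter fun u => κ u = r).card : ZMod 2) = a r) :
    (O.card : ZMod 2) = ∑ r, a r := by
  rw [card_eq_sum_fiber κ O, Nat.cast_sum]
  exact Finset.sum_congr rfl fun r _ => hO r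

variable [Fintype V] [DecidableEq V]

/-- A set of `m` elements meeting each fiber of `κ` with prescribed parity exists as soon as neither
it nor its complement is too small to do so. -/
theorem exists_card_parity_iff (κ : V → ι) (a : ι → ZMod 2)
    (hne : ∀ r, a r = 1 → ∃ u, κ u = r) (hsum : ((Fintype.card V / 2 : ℕ) : ZMod 2) = ∑ r, a r) :
    (∃ O : Finset V, O.card = Fintype.card V / 2 ∧
      ∀ r, ((O.filter fun u => κ u = r).card : ZMod 2) = a r) ↔
    2 * (univ.filter fun r => a r = 1).card ≤ Fintype.card V + 1 ∧
      2 * (univ.filter fun r => ((univ.filter fun u => κ u = r).card : ZMod 2) + a r = 1).card ≤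
        Fintype.card V + 1 := by
  have hcompl : ∀ O : Finset V, (∀ r, ((O.filter fun u => κ u = r).card : ZMod 2) = a r) → ∀ r,
      ((Oᶜ.filter fun u => κ u = r).card : ZMod 2) =
        ((univ.filter fun u => κ u = r).card : ZMod 2) + a r := by
    intro O hO r
    have : (univ.filter fun u => κ u = r).card =
        (O.filter fun u => κ u = r).card + (Oᶜ.filter fun u => κ u = r).card := by
      rw [← Finset.card_union_of_disjoint
        (Finset.disjoint_filter_filter disjoint_compl_right), ← Finset.filter_union,
        Finset.union_compl]
    rw [this, Nat.cast_add, hO r]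
    linear_combination -(a r) * two_eq_zero
  constructor
  · rintro ⟨O, hcard, hO⟩
    have h₁ := card_odd_le κ a hO
    have h₂ := card_odd_le κ _ (hcompl O hO)
    rw [Finset.card_compl] at h₂
    constructor <;> omega
  · rintro ⟨hα, hβ⟩
    have hmod : ∀ O : Finset V, (∀ r, ((O.filter fun u => κ u = r).card : ZMod 2) = a r) →
        O.card % 2 = Fintype.card V / 2 % 2 := by
      intro O hO
      have := (natCast_card_eq κ a hO).trans hsum.symm
      exact (ZMod.natCast_eq_natCast_iff' _ _ 2).mp this
    choose f hf using hne
    -- The smallest candidate: one vertex from each fiber with odd requirement.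
    obtain ⟨O₀, hO₀, hcard₀⟩ : ∃ O : Finset V,
        (∀ r, ((O.filter fun u => κ u = r).card : ZMod 2) = a r) ∧
          O.card = (univ.filter fun r => a r = 1).card := by
      let g : {r // a r = 1} → V := fun r => f r.1 r.2
      have hg : Function.Injective g := by
        intro r r' h
        have := congrArg κ h
        simp only [g, hf] at this
        exact Subtype.ext this
      refine ⟨univ.image g, fun r => ?_, ?_⟩
      · rcases zmod_two_cases (a r) with h | h
        · have : (univ.image g).filter (fun u => κ u = r) = ∅ := by
            ext u
            simp only [mem_filter, mem_image, mem_univ, true_and, notMem_empty, iff_false]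
            rintro ⟨⟨r', rfl⟩, h'⟩
            simp only [g, hf] at h'
            have := r'.2
            rw [h', h] at this
            exact absurd this (by decide)
          rw [this, h]
          simp
        · have : (univ.image g).filter (fun u => κ u = r) = {f r h} := by
            ext u
            simp only [mem_filter, mem_image, mem_univ, true_and, mem_singleton]
            constructor
            · rintro ⟨⟨r', rfl⟩, h'⟩
              simp only [g, hf] at h'
              subst h'
              rfl
            · rintro rfl
              exact ⟨⟨⟨r, h⟩, rfl⟩, hf r h⟩
          rw [this, h]
          simp
      · rw [Finset.card_image_of_injective _ hg, Finset.card_univ, Fintype.card_subtype]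
    -- For odd order the bound leaves a slack of one, which the parity of `O₀.card` rules out.
    have hle₀ : O₀.card ≤ Fintype.card V / 2 := by
      have := hmod O₀ hO₀
      omega
    obtain ⟨O, hOmem, hmax⟩ := Finset.exists_max_image
      (univ.filter fun O : Finset V => (∀ r, ((O.filter fun u => κ u = r).card : ZMod 2) = a r) ∧
        O.card ≤ Fintype.card V / 2) Finset.card ⟨O₀, by simpa using ⟨hO₀, hle₀⟩⟩
    simp only [mem_filter, mem_univ, true_and] at hOmem hmax
    obtain ⟨hO, hle⟩ := hOmem
    refine ⟨O, ?_, hO⟩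
    by_contra hlt
    have hO2 : O.card + 2 ≤ Fintype.card V / 2 := by
      have := hmod O hO
      omega
    -- Two omitted vertices in one fiber could both be added without changing any parity, against
    -- maximality. So the complement has at most one vertex per fiber, and its size is bounded by
    -- the second count.
    have hsmall : ∀ r, (Oᶜ.filter fun u => κ u = r).card ≤ 1 := by
      intro r
      by_contra h
      obtain ⟨u, hu, v, hv, huv⟩ := Finset.one_lt_card.mp (not_le.mp h)
      simp only [mem_filter, mem_compl] at hu hv
      have hu' : u ∉ insert v O := by simp [huv, hu.1]
      have hcard : (insert u (insert v O)).card = O.card + 2 := by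
        rw [card_insert_of_notMem hu', card_insert_of_notMem hv.1]
      have := hmax (insert u (insert v O)) ⟨fun s => ?_, by omega⟩
      · omega
      · rw [Finset.filter_insert, Finset.filter_insert, hu.2, hv.2]
        by_cases hs : r = s
        · simp only [hs, if_true]
          rw [card_insert_of_notMem (by simp [huv, hu.1]), card_insert_of_notMem (by simp [hv.1])]
          push_cast
          rw [hO]
          linear_combination two_eq_zero
        · simp only [hs, if_false]
          exact hO s
    have hcount : Oᶜ.card ≤
        (univ.filter fun r => ((univ.filter fun u => κ u = r).card : ZMod 2) + a r = 1).card := by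
      rw [card_eq_sum_fiber κ Oᶜ, Finset.card_filter]
      refine Finset.sum_le_sum fun r _ => ?_
      split_ifs with h
      · exact hsmall r
      · have h₁ := hsmall r
        have h₂ : (Oᶜ.filter fun u => κ u = r).card ≠ 1 := by
          intro h'
          have := hcompl O hO r
          rw [h', Nat.cast_one] at this
          exact h this.symm
        omega
    rw [Finset.card_compl] at hcount
    omega

theorem card_filter_odd (n : ℕ) : (univ.filter fun i : Fin n => (i : ℕ) % 2 = 1).card = n / 2 := by
  induction n with
  | zero => rfl
  | succ n ih =>
    have e : (univ.filter ((fun i : Fin (n + 1) => (i : ℕ) % 2 = 1) ∘ Fin.castSuccEmb)).card =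
        n / 2 := ih
    rw [Fin.univ_castSuccEmb, Finset.filter_cons]
    split_ifs with h
    · rw [Finset.card_cons, Finset.filter_map, Finset.card_map, e]
      rw [Fin.val_last] at h
      omega
    · rw [Finset.filter_map, Finset.card_map, e]
      rw [Fin.val_last] at h
      omega

theorem natCast_eq_ite (k : ℕ) : (k : ZMod 2) = if k % 2 = 1 then 1 else 0 := by
  split_ifs with h
  · exact (ZMod.natCast_eq_one_iff_odd).mpr (Nat.odd_iff.mpr h)
  · exact (ZMod.natCast_eq_zero_iff_even).mpr (Nat.even_iff.mpr (by omega))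

/-- Positions in a linear order matter only through their parity. -/
theorem exists_order_sum_iff {V ι : Type*} [Fintype V] [DecidableEq V] [DecidableEq ι] (κ : V → ι) (a : ι → ZMod 2) :
    (∃ σ : V ≃ Fin (Fintype.card V), ∀ r, ∑ u with κ u = r, ((σ u : ℕ) : ZMod 2) = a r) ↔
      ∃ O : Finset V, O.card = Fintype.card V / 2 ∧
        ∀ r, ((O.filter fun u => κ u = r).card : ZMod 2) = a r := by
  have key : ∀ (σ : V ≃ Fin (Fintype.card V)) (O : Finset V),
      (∀ u, u ∈ O ↔ (σ u : ℕ) % 2 = 1) → ∀ r,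
        ∑ u with κ u = r, ((σ u : ℕ) : ZMod 2) = (O.filter fun u => κ u = r).card := by
    intro σ O hO r
    rw [Finset.sum_congr rfl fun u _ => natCast_eq_ite _]
    simp only [← hO]
    rw [Finset.sum_boole, Finset.filter_comm, Finset.filter_univ_mem]
  constructor
  · rintro ⟨σ, hσ⟩
    have hO : ∀ u, u ∈ (univ.filter fun u => (σ u : ℕ) % 2 = 1) ↔ (σ u : ℕ) % 2 = 1 := by simp
    refine ⟨univ.filter fun u => (σ u : ℕ) % 2 = 1, ?_, fun r => ?_⟩
    · rw [← card_filter_odd (Fintype.card V), ← Finset.card_map σ.toEmbedding]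
      congr 1
      ext i
      simp only [mem_map_equiv, mem_filter, mem_univ, true_and, Equiv.apply_symm_apply]
    · rw [← key σ _ hO, hσ]
  · rintro ⟨O, hcard, hO⟩
    have h₁ : Fintype.card {u // u ∈ O} =
        Fintype.card {i : Fin (Fintype.card V) // (i : ℕ) % 2 = 1} := by
      rw [Fintype.card_coe, Fintype.card_subtype, card_filter_odd, hcard]
    have h₂ : Fintype.card {u // ¬ u ∈ O} =
        Fintype.card {i : Fin (Fintype.card V) // ¬ (i : ℕ) % 2 = 1} := by
      rw [Fintype.card_subtype_compl, Fintype.card_subtype_compl, h₁, Fintype.card_fin]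
    let σ : V ≃ Fin (Fintype.card V) := (Equiv.sumCompl (· ∈ O)).symm.trans
      (((Fintype.equivOfCardEq h₁).sumCongr (Fintype.equivOfCardEq h₂)).trans
        (Equiv.sumCompl fun i : Fin (Fintype.card V) => (i : ℕ) % 2 = 1))
    refine ⟨σ, fun r => ?_⟩
    rw [key σ O ?_, hO]
    intro u
    by_cases hu : u ∈ O
    · simp only [hu, true_iff, σ, Equiv.trans_apply, Equiv.sumCompl_symm_apply_of_pos,
        Equiv.sumCongr_apply, Sum.map_inl, Equiv.sumCompl_apply_inl]
      exact (Fintype.equivOfCardEq h₁ ⟨u, hu⟩).2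
    · simp only [hu, false_iff, σ, Equiv.trans_apply, Equiv.sumCompl_symm_apply_of_neg,
        Equiv.sumCongr_apply, Sum.map_inr, Equiv.sumCompl_apply_inr, not_false_eq_true]
      exact (Fintype.equivOfCardEq h₂ ⟨u, hu⟩).2

/-- If a function has even sums over the connected components of a graph, as collected by `κ`, then
the graph has a subgraph whose degrees have the parities given by the function. -/
theorem exists_join (G : SimpleGraph V) (κ : V → V) (hκ : ∀ v, G.Reachable v (κ v))
    (t : V → ZMod 2) (ht : ∀ r, ∑ v with κ v = r, t v = 0) :
    ∃ S : V → V → ZMod 2, (∀ u v, S u v = S v u) ∧ (∀ u, S u u = 0) ∧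
      (∀ u v, ¬ G.Adj u v → S u v = 0) ∧ ∀ u, ∑ v, S u v = t u := by
  have path : ∀ u w, G.Reachable u w → ∃ S : V → V → ZMod 2, (∀ u v, S u v = S v u) ∧
      (∀ u, S u u = 0) ∧ (∀ u v, ¬ G.Adj u v → S u v = 0) ∧
        ∀ x, ∑ y, S x y = ind {u} x + ind {w} x := by
    rintro u w ⟨q⟩
    induction q with
    | nil =>
      refine ⟨0, by simp, by simp, by simp, fun x => ?_⟩
      rw [CharTwo.add_self_eq_zero]
      simp
    | @cons u v w h q ih =>
      obtain ⟨S, h₁, h₂, h₃, h₄⟩ := ih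
      refine ⟨edge u v + S, fun x y => ?_, fun x => ?_, fun x y hxy => ?_, fun x => ?_⟩
      · simp [h₁ x y, edge_symm u v x y]
      · simp [h₂, edge_self]
      · simp only [Pi.add_apply, h₃ x y hxy, add_zero, edge, ind, mem_singleton]
        have := h.symm
        split_ifs <;> simp_all
      · simp only [Pi.add_apply, Finset.sum_add_distrib, sum_edge, h₄]
        linear_combination ind {v} x * two_eq_zero
  choose P h₁ h₂ h₃ h₄ using fun v => path v (κ v) (hκ v)
  -- Each vertex with `t v = 1` is joined to its root by a path. At the root the degrees add up to
  -- the sum of `t` over the fiber, which vanishes.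
  refine ⟨∑ v, t v • P v, fun x y => ?_, fun x => ?_, fun x y hxy => ?_, fun x => ?_⟩
  · simp only [Finset.sum_apply, Pi.smul_apply, h₁ _ x y]
  · simp [Finset.sum_apply, h₂]
  · simp [Finset.sum_apply, h₃ _ x y hxy]
  · simp only [Finset.sum_apply, Pi.smul_apply, smul_eq_mul]
    rw [Finset.sum_comm]
    simp only [← Finset.mul_sum, h₄, mul_add, Finset.sum_add_distrib]
    have e₁ : ∑ v, t v * ind {v} x = t x := by simp [ind]
    have e₂ : ∑ v, t v * ind {κ v} x = 0 := by
      rw [← ht x, Finset.sum_filter]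
      refine Finset.sum_congr rfl fun v _ => ?_
      simp [ind, eq_comm]
    rw [e₁, e₂, add_zero]

end Parity

/-! ### Components of the complement and the counting criterion -/

section Components

variable {V : Type*} [Fintype V] [LinearOrder V]

/-- The graph in which two vertices are adjacent if there is no arc between them. -/
def complGraph (D : OrientedGraph V) : SimpleGraph V where
  Adj u v := u ≠ v ∧ ¬ D.Adj u v ∧ ¬ D.Adj v u
  symm := ⟨fun _ _ h => ⟨h.1.symm, h.2.2, h.2.1⟩⟩
  loopless := ⟨fun _ h => h.1 rfl⟩

open scoped Classical in
/-- The least vertex in the component of `v` in the complement. -/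
noncomputable def root (D : OrientedGraph V) (v : V) : V :=
  (univ.filter fun u => D.complGraph.Reachable v u).min' ⟨v, by simp⟩

theorem reachable_root (D : OrientedGraph V) (v : V) : D.complGraph.Reachable v (D.root v) := by
  classical
  unfold root
  exact (Finset.mem_filter.mp (Finset.min'_mem _ _)).2

theorem root_le (D : OrientedGraph V) {u v : V} (h : D.complGraph.Reachable v u) :
    D.root v ≤ u :=
  Finset.min'_le _ _ (by simpa using h)

theorem root_eq_root_iff (D : OrientedGraph V) {u v : V} :
    D.root u = D.root v ↔ D.complGraph.Reachable u v := by
  constructor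
  · intro h
    exact (D.reachable_root u).trans (h ▸ (D.reachable_root v).symm)
  · intro h
    exact le_antisymm (D.root_le (h.trans (D.reachable_root v)))
      (D.root_le (h.symm.trans (D.reachable_root u)))

open scoped Classical in
/-- The entries whose sum over `u` in a component and all `v` is the parity assigned to it. -/
noncomputable def weight (D : OrientedGraph V) (u v : V) : ZMod 2 :=
  if D.root v = D.root u then (if u < v then 1 else 0) else if D.Adj u v then 1 else 0

/-- The parity of the number of vertices at odd positions in the component with root `r`. -/
noncomputable def parity (D : OrientedGraph V) (r : V) : ZMod 2 :=
  ∑ u with D.root u = r, ∑ v, D.weight u v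

/-- The matrix `H` adds to the mismatch the indicator of preceding vertices, whose row sums are the
positions, and the weight. Between components every pair carries an arc, and `H` vanishes there in
either direction of the arc. Inside a component `H` is symmetric, the term `u < v` of the weight
compensating the asymmetry of the positions, so the handshake lemma applies. -/
theorem sum_mismatch (D : OrientedGraph V) (σ : V ≃ Fin (Fintype.card V)) (r : V) :
    ∑ u with D.root u = r, ∑ v, D.mismatch (fun v => σ v) u v =
      ∑ u with D.root u = r, ((σ u : ℕ) : ZMod 2) + D.parity r := by
  set H : V → V → ZMod 2 := fun u v => D.mismatch (fun v => σ v) u v +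
    (if (σ v : ℕ) < σ u then 1 else 0) + D.weight u v with hH
  have two : (1 : ZMod 2) + 1 = 0 := rfl
  have hne : ∀ u v, u ≠ v → (σ u : ℕ) ≠ σ v := fun u v h h' => h (σ.injective (Fin.ext h'))
  have hzero : ∀ u v, D.root u = r → D.root v ≠ r → H u v = 0 := by
    intro u v hu hv
    have huv : D.root v ≠ D.root u := by rwa [hu]
    have hnv : u ≠ v := by rintro rfl; exact huv rfl
    have hadj : D.Adj u v ∨ D.Adj v u := by
      by_contra h
      rw [not_or] at h
      exact huv ((D.root_eq_root_iff).mpr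
        (SimpleGraph.Adj.reachable (G := D.complGraph) ⟨hnv, h⟩).symm)
    have h₁ := D.asymm u v
    have h₂ := D.asymm v u
    have h₃ := hne u v hnv
    simp only [hH, mismatch, weight, huv, if_false]
    rcases hadj with h | h <;> rcases lt_or_gt_of_ne h₃ with h' | h' <;>
      simp [h, h', h₁, h₂, h'.not_gt, two]
  have hin : ∑ u with D.root u = r, ∑ v with D.root v = r, H u v = 0 := by
    refine sum_sum_eq_zero _ _ ?_ ?_
    · intro u hu v hv
      simp only [mem_filter, mem_univ, true_and] at hu hv
      by_cases huv : u = v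
      · rw [huv]
      · have h₃ := hne u v huv
        simp only [hH, D.mismatch_symm _ u v, weight, hu, hv, if_true, add_assoc]
        congr 1
        rcases lt_or_gt_of_ne h₃ with h | h <;> rcases lt_or_gt_of_ne huv with h' | h' <;>
          simp [h, h', h.not_gt, h'.not_gt] <;> rfl
    · intro u _
      simp [hH, mismatch_self, weight]
  have hall : ∑ u with D.root u = r, ∑ v, H u v = 0 := by
    rw [← hin]
    refine Finset.sum_congr rfl fun u hu => ?_
    rw [Finset.sum_filter]
    refine Finset.sum_congr rfl fun v _ => ?_
    split_ifs with h
    · rfl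
    · exact hzero u v (by simpa using hu) h
  simp only [hH, Finset.sum_add_distrib, sum_lt_eq] at hall
  unfold parity
  linear_combination hall - (∑ u with D.root u = r, ((σ u : ℕ) : ZMod 2) +
    ∑ u with D.root u = r, ∑ v, D.weight u v) * two_eq_zero

/-- On arcs S must equal the mismatch, so the difference lives on complement edges, inside
components, where degree sums are even. Conversely a join in the complement corrects the degrees of
the mismatch without touching any arc. -/
theorem exists_even_iff (D : OrientedGraph V) (σ : V ≃ Fin (Fintype.card V)) :
    (∃ S : V → V → ZMod 2, (∀ u v, S u v = S v u) ∧ (∀ u, S u u = 0) ∧ (∀ u, ∑ v, S u v = 0) ∧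
      ∀ u v, D.FlipAdj S u v → σ v < σ u) ↔
    ∀ r, ∑ u with D.root u = r, ((σ u : ℕ) : ZMod 2) = D.parity r := by
  have hiff : ∀ r, ∑ u with D.root u = r, ((σ u : ℕ) : ZMod 2) = D.parity r ↔
      ∑ u with D.root u = r, ∑ v, D.mismatch (fun v => σ v) u v = 0 := by
    intro r
    rw [sum_mismatch]
    exact (CharTwo.add_eq_zero).symm
  simp only [hiff]
  have hinj : Function.Injective fun v => (σ v : ℕ) :=
    fun u v h => σ.injective (Fin.ext h)
  constructor
  · rintro ⟨S, hsymm, hdiag, hsum, hσ⟩ r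
    set S' : V → V → ZMod 2 := S + D.mismatch (fun v => σ v) with hS'
    have hadj : ∀ u v, D.Adj u v → S u v = D.mismatch (fun v => σ v) u v := by
      intro u v h
      have hn := D.asymm u v h
      rcases zmod_two_cases (S u v) with hs | hs
      · have : (σ v : ℕ) < σ u := hσ u v (Or.inl ⟨hs, h⟩)
        simp [mismatch, hs, hn, this.not_gt]
      · have : (σ u : ℕ) < σ v := hσ v u (Or.inr ⟨hsymm u v ▸ hs, h⟩)
        simp [mismatch, hs, h, this]
    have hzero : ∀ u v, D.root v ≠ D.root u → S' u v = 0 := by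
      intro u v huv
      have hnv : u ≠ v := by rintro rfl; exact huv rfl
      have : D.Adj u v ∨ D.Adj v u := by
        by_contra h
        rw [not_or] at h
        exact huv ((D.root_eq_root_iff).mpr
          (SimpleGraph.Adj.reachable (G := D.complGraph) ⟨hnv, h⟩).symm)
      have e : S u v = D.mismatch (fun v => σ v) u v := by
        rcases this with h | h
        · exact hadj u v h
        · rw [hsymm, mismatch_symm]
          exact hadj v u h
      simp only [hS', Pi.add_apply, e]
      exact CharTwo.add_self_eq_zero _
    have hin : ∑ u with D.root u = r, ∑ v with D.root v = r, S' u v = 0 :=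
      sum_sum_eq_zero _ _ (fun u _ v _ => by simp [hS', hsymm u v, D.mismatch_symm _ u v])
        fun u _ => by simp [hS', hdiag, mismatch_self]
    rw [← hin]
    refine Finset.sum_congr rfl fun u hu => ?_
    have e : ∑ v, D.mismatch (fun v => σ v) u v = ∑ v, S' u v := by
      simp [hS', Finset.sum_add_distrib, hsum]
    rw [e, Finset.sum_filter]
    refine Finset.sum_congr rfl fun v _ => ?_
    simp only [mem_filter, mem_univ, true_and] at hu
    split_ifs with h
    · rfl
    · exact hzero u v (by rwa [hu])
  · intro h
    obtain ⟨T, h₁, h₂, h₃, h₄⟩ := exists_join D.complGraph D.root D.reachable_root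
      (fun u => ∑ v, D.mismatch (fun v => σ v) u v) h
    refine ⟨D.mismatch (fun v => σ v) + T, fun u v => ?_, fun u => ?_, fun u => ?_,
      fun u v huv => ?_⟩
    · simp [h₁ u v, D.mismatch_symm _ u v]
    · simp [h₂, mismatch_self]
    · simp only [Pi.add_apply, Finset.sum_add_distrib, h₄]
      exact CharTwo.add_self_eq_zero _
    · have hT : T u v = 0 := by
        refine h₃ u v fun hc => ?_
        rcases huv with ⟨-, h⟩ | ⟨-, h⟩
        · exact hc.2.1 h
        · exact hc.2.2 h
      refine flipAdj_mismatch hinj (D := D) (u := u) (v := v) ?_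
      simpa [FlipAdj, hT] using huv

/-- Sum `sum_mismatch` over all roots for any one order: the mismatch contributes zero by the
handshake lemma, and ⌊n/2⌋ positions are odd. -/
theorem sum_parity (D : OrientedGraph V) :
    ((Fintype.card V / 2 : ℕ) : ZMod 2) = ∑ r, D.parity r := by
  let σ := Fintype.equivFin V
  have h₁ : ∑ r, ∑ u with D.root u = r, ∑ v, D.mismatch (fun v => σ v) u v = 0 := by
    rw [Finset.sum_fiberwise]
    exact sum_sum_eq_zero univ _ (fun u _ v _ => D.mismatch_symm _ u v)
      fun u _ => D.mismatch_self _ u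
  simp only [sum_mismatch, Finset.sum_add_distrib] at h₁
  rw [Finset.sum_fiberwise, CharTwo.add_eq_zero] at h₁
  rw [← h₁, σ.sum_comp fun i => ((i : ℕ) : ZMod 2)]
  simp only [natCast_eq_ite]
  rw [Finset.sum_boole, card_filter_odd, natCast_eq_ite]

theorem isEqInvertible_iff_card {p : ℕ} (hp : 3 ≤ p) (hodd : Odd p)
    (hV : p + 2 ≤ Fintype.card V) (D : OrientedGraph V) :
    D.IsEqInvertible p ↔ 2 * (univ.filter fun r => D.parity r = 1).card ≤ Fintype.card V + 1 ∧
      2 * (univ.filter fun r =>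
        ((univ.filter fun u => D.root u = r).card : ZMod 2) + D.parity r = 1).card ≤
          Fintype.card V + 1 := by
  rw [isEqInvertible_iff_of_odd hp hodd hV, ← exists_card_parity_iff D.root D.parity ?_
    D.sum_parity, ← exists_order_sum_iff]
  · simp only [← exists_even_iff]
    constructor
    · rintro ⟨S, h₁, h₂, h₃, σ, h₄⟩
      exact ⟨σ, S, h₁, h₂, h₃, h₄⟩
    · rintro ⟨σ, S, h₁, h₂, h₃, h₄⟩
      exact ⟨S, h₁, h₂, h₃, σ, h₄⟩
  -- A vertex that is not a root labels an empty fiber, whose parity is an empty sum.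
  · intro r hr
    by_contra h
    have : (univ.filter fun u => D.root u = r) = ∅ := by
      ext u
      simpa using fun hu => h ⟨u, hu⟩
    rw [parity, this] at hr
    exact absurd hr (by simp)

end Components

end OrientedGraph

/-! ### Degenerate sizes, and reachability by iteration -/

namespace OrientedGraph

open Finset

section Small

variable {V : Type*}

theorem isAcyclic_invert_iff [Fintype V] {D : OrientedGraph V} {X : Finset V}
    (h : X.card = 1 ∨ X = univ) : (D.invert X).IsAcyclic ↔ D.IsAcyclic := by
  rcases h with h | rfl
  · obtain ⟨x, rfl⟩ := Finset.card_eq_one.mp h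
    have : (D.invert {x}).Adj = D.Adj := by
      funext u v
      simp only [invert, mem_singleton, eq_iff_iff]
      constructor
      · rintro (⟨rfl, rfl, h⟩ | ⟨-, h⟩)
        · exact h
        · exact h
      · intro h
        refine Or.inr ⟨?_, h⟩
        rintro ⟨rfl, rfl⟩
        exact D.not_adj_self _ ‹_›
    simp only [IsAcyclic, this]
  · have : (D.invert univ).Adj = Function.swap D.Adj := by
      funext u v
      simp [invert, Function.swap]
    simp only [IsAcyclic, this, Relation.transGen_swap]

/-- Inversions of singletons change nothing, and there is at most one set with at least as many
elements as there are vertices, whose inversion reverses all arcs. -/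
theorem isEqInvertible_iff_isAcyclic [Fintype V] {p : ℕ} (h : p = 1 ∨ Fintype.card V ≤ p)
    (D : OrientedGraph V) : D.IsEqInvertible p ↔ D.IsAcyclic := by
  have hX : ∀ X : Finset V, X.card = p → X.card = 1 ∨ X = univ := by
    intro X hX
    refine h.imp (fun h => hX.trans h) fun h => ?_
    exact (Finset.card_eq_iff_eq_univ X).mp (le_antisymm (Finset.card_le_univ X) (hX ▸ h))
  constructor
  · rintro ⟨F, hF, h⟩
    induction F generalizing D with
    | nil => exact h
    | cons X F ih =>
      exact (isAcyclic_invert_iff (hX X (hF X (by simp)))).mp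
        (ih _ (fun Y hY => hF Y (by simp [hY])) h)
  · intro h
    exact ⟨[], by simp, h⟩

end Small

section Iteration

variable {n : ℕ}

/-- The heads of arcs with tail in `P`. -/
def outSet (D : OrientedGraph (Fin n)) (P : Fin n → Prop) (i : Fin n) : Prop :=
  ∃ j, P j ∧ D.Adj j i

/-- After t rounds the set consists of the ends of walks with t arcs. Without cycles positions drop
along a walk, so n arcs are impossible; a vertex on a closed walk is never lost. -/
theorem isAcyclic_iff_iterate (D : OrientedGraph (Fin n)) :
    D.IsAcyclic ↔ ∀ i, ¬ (D.outSet^[n] fun _ => True) i := by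
  constructor
  · intro h
    obtain ⟨σ, hσ⟩ := exists_order_of_acyclic h
    have key : ∀ t i, (D.outSet^[t] fun _ => True) i → (σ i : ℕ) + t < n := by
      intro t
      induction t with
      | zero => exact fun i _ => (σ i).2.trans_eq (Fintype.card_fin n)
      | succ t ih =>
        intro i hi
        rw [Function.iterate_succ_apply'] at hi
        obtain ⟨j, hj, hji⟩ := hi
        have h₁ := ih j hj
        have h₂ : (σ i : ℕ) < σ j := hσ j i hji
        omega
    intro i hi
    have := key n i hi
    omega
  · intro h v hv
    have key : ∀ t u, Relation.TransGen D.Adj u u → (D.outSet^[t] fun _ => True) u := by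
      intro t
      induction t with
      | zero => exact fun _ _ => trivial
      | succ t ih =>
        intro u hu
        obtain ⟨w, huw, hwu⟩ := Relation.TransGen.tail'_iff.mp hu
        rw [Function.iterate_succ_apply']
        exact ⟨w, ih w (Relation.TransGen.head' hwu huw), hwu⟩
    exact h v (key n v hv)

/-- The vertices that have no arc to some vertex of `P`, in either direction. -/
def nonNeighbors (D : OrientedGraph (Fin n)) (P : Fin n → Prop) (i : Fin n) : Prop :=
  ∃ j, P j ∧ ¬ D.Adj j i ∧ ¬ D.Adj i j

/-- Every vertex is a non-neighbor of itself, so a vertex once reached stays. A path in the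
complement has fewer than n edges, so n rounds reach the whole component. -/
theorem iterate_nonNeighbors_iff (D : OrientedGraph (Fin n)) (v i : Fin n) :
    (D.nonNeighbors^[n] fun u => u = v) i ↔ D.root i = D.root v := by
  rw [root_eq_root_iff]
  constructor
  · have key : ∀ t i, (D.nonNeighbors^[t] fun u => u = v) i → D.complGraph.Reachable i v := by
      intro t
      induction t with
      | zero =>
        rintro i rfl
        exact SimpleGraph.Reachable.refl _
      | succ t ih =>
        intro i hi
        rw [Function.iterate_succ_apply'] at hi
        obtain ⟨j, hj, h₁, h₂⟩ := hi
        by_cases hij : i = j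
        · exact hij ▸ ih j hj
        · exact (SimpleGraph.Adj.reachable (G := D.complGraph) ⟨hij, h₂, h₁⟩).trans (ih j hj)
    exact key n i
  · intro h
    obtain ⟨q, hq⟩ := h.symm.exists_isPath
    have key : ∀ (u w : Fin n) (q : D.complGraph.Walk u w) (t : ℕ),
        (D.nonNeighbors^[t] fun u => u = v) u →
          (D.nonNeighbors^[t + q.length] fun u => u = v) w := by
      intro u w q
      induction q with
      | nil => exact fun t h => h
      | @cons a b c hab q ih =>
        intro t h
        have := ih (t + 1) (by
          rw [Function.iterate_succ_apply']
          exact ⟨a, h, hab.2⟩)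
        rwa [SimpleGraph.Walk.length_cons, Nat.add_comm q.length, ← Nat.add_assoc]
    have mono : ∀ k t, (D.nonNeighbors^[t] fun u => u = v) i →
        (D.nonNeighbors^[t + k] fun u => u = v) i := by
      intro k t h
      induction k with
      | zero => exact h
      | succ k ih =>
        rw [← Nat.add_assoc, Function.iterate_succ_apply']
        exact ⟨i, ih, D.not_adj_self i, D.not_adj_self i⟩
    have hlt := hq.length_lt
    rw [Fintype.card_fin] at hlt
    have := mono (n - q.length) _ (key v i q 0 rfl)
    convert this using 2
    omega

theorem root_root (D : OrientedGraph (Fin n)) (v : Fin n) : D.root (D.root v) = D.root v :=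
  D.root_eq_root_iff.mpr (D.reachable_root v).symm

theorem root_eq_self_iff (D : OrientedGraph (Fin n)) (v : Fin n) :
    D.root v = v ↔ ¬ ∃ u, D.root u = D.root v ∧ u < v := by
  constructor
  · rintro h ⟨u, hu, huv⟩
    have := D.root_le (D.root_eq_root_iff.mp hu.symm)
    rw [h] at this
    exact absurd huv this.not_gt
  · intro h
    by_contra hne
    exact h ⟨D.root v, D.root_root v, lt_of_le_of_ne (D.root_le (SimpleGraph.Reachable.refl _)) hne⟩

theorem fiber_eq_empty (D : OrientedGraph (Fin n)) {v : Fin n} (h : D.root v ≠ v) :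
    (univ.filter fun u => D.root u = v) = ∅ := by
  refine Finset.filter_eq_empty_iff.mpr fun u _ hu => h ?_
  rw [← hu, root_root]

end Iteration

end OrientedGraph

/-! ### Meaning of the queries and of the input string -/

namespace StackProg

open Turing Function Computability

namespace Query

variable {B : Type} [DecidableEq B] {n : ℕ}

theorem eval_fold_or (i : B) (e : Query B) (M : List Bool) (ρ : B → ℕ) (V : B → List Bool) :
    (fold or i e).eval n M ρ V = true ↔ ∃ j : Fin n, e.eval n M (update ρ i j) V = true := by
  have : ∀ (l : List ℕ) (b : Bool), l.foldl (fun b j => b || e.eval n M (update ρ i j) V) b = true ↔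
      b = true ∨ ∃ j ∈ l, e.eval n M (update ρ i j) V = true := by
    intro l
    induction l with
    | nil => simp
    | cons a l ih => intro b; simp [ih, or_assoc]
  simp only [eval]
  rw [this]
  simp [Fin.exists_iff]

/-- A truth value as an element of the field with two elements. -/
def toZMod (b : Bool) : ZMod 2 := if b then 1 else 0

theorem toZMod_eq_one {b : Bool} : toZMod b = 1 ↔ b = true := by cases b <;> decide

theorem toZMod_xor (b c : Bool) : toZMod (xor b c) = toZMod b + toZMod c := by
  cases b <;> cases c <;> decide

theorem toZMod_and (b c : Bool) : toZMod (b && c) = toZMod b * toZMod c := by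
  cases b <;> cases c <;> decide

theorem toZMod_eval_fold_xor (i : B) (e : Query B) (M : List Bool) (ρ : B → ℕ)
    (V : B → List Bool) : toZMod ((fold xor i e).eval n M ρ V) =
      ∑ j : Fin n, toZMod (e.eval n M (update ρ i j) V) := by
  have : ∀ (l : List ℕ) (b : Bool),
      toZMod (l.foldl (fun b j => xor b (e.eval n M (update ρ i j) V)) b) =
        toZMod b + (l.map fun j => toZMod (e.eval n M (update ρ i j) V)).sum := by
    intro l
    induction l with
    | nil => simp
    | cons a l ih => intro b; simp [ih, toZMod_xor, add_assoc]
  simp only [eval]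
  rw [this, Fin.sum_univ_def, ← List.map_coe_finRange_eq_range, List.map_map]
  exact zero_add _

theorem eval_few (i : B) (e : Query B) (M : List Bool) (ρ : B → ℕ) (V : B → List Bool) :
    (few i e).eval n M ρ V = true ↔
      2 * (Finset.univ.filter fun j : Fin n => e.eval n M (update ρ i j) V = true).card ≤ n + 1 := by
  simp only [eval, decide_eq_true_eq]
  have : (List.range n).countP (fun j => e.eval n M (update ρ i j) V) =
      (Finset.univ.filter fun j : Fin n => e.eval n M (update ρ i j) V = true).card := by
    rw [← List.map_coe_finRange_eq_range, List.countP_map, ← List.toFinset_finRange n,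
      (List.nodup_finRange n).card_eq_countP]
    exact List.countP_congr fun j _ => by simp
  rw [this]

/-- A simulation argument: the rounds on bit lists mirror the rounds on predicates, provided that
one round does. -/
theorem iterate_getD {g₀ : ℕ → Bool} {g₁ : List Bool → ℕ → Bool} {P₀ : Fin n → Prop}
    {F : (Fin n → Prop) → Fin n → Prop} (h₀ : ∀ i : Fin n, g₀ i = true ↔ P₀ i)
    (h₁ : ∀ W P, (∀ i : Fin n, W[(i : ℕ)]?.getD false = true ↔ P i) →
      ∀ i : Fin n, g₁ W i = true ↔ F P i) (t : ℕ) (i : Fin n) :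
    ((fun W => (List.range n).map (g₁ W))^[t] ((List.range n).map g₀))[(i : ℕ)]?.getD false = true ↔
      F^[t] P₀ i := by
  induction t generalizing i with
  | zero => simp [h₀]
  | succ t ih =>
    rw [iterate_succ_apply', iterate_succ_apply', ← h₁ _ _ ih]
    simp

theorem eval_iter {x i : B} {e₀ e₁ : Query B} (e : Query B) {M : List Bool} {ρ : B → ℕ}
    {V : B → List Bool} {P₀ : Fin n → Prop} {F : (Fin n → Prop) → Fin n → Prop}
    (h₀ : ∀ j : Fin n, e₀.eval n M (update ρ i j) V = true ↔ P₀ j)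
    (h₁ : ∀ W P, (∀ j : Fin n, W[(j : ℕ)]?.getD false = true ↔ P j) →
      ∀ j : Fin n, e₁.eval n M (update ρ i j) (update V x W) = true ↔ F P j) :
    ∃ W, (∀ j : Fin n, W[(j : ℕ)]?.getD false = true ↔ F^[n] P₀ j) ∧
      (iter x i e₀ e₁ e).eval n M ρ V = e.eval n M ρ (update V x W) :=
  ⟨_, iterate_getD h₀ h₁ n, rfl⟩

end Query

/-- The rows of the adjacency matrix. -/
noncomputable def adjRows {n : ℕ} (D : OrientedGraph (Fin n)) : List (List Bool) :=
  open scoped Classical in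
  List.ofFn fun u => List.ofFn fun v => decide (D.Adj u v)

theorem getD_flatten_adjRows {n : ℕ} (D : OrientedGraph (Fin n)) (u v : Fin n) :
    (adjRows D).flatten[(u : ℕ) * n + v]?.getD false = true ↔ D.Adj u v := by
  classical
  have div : ∀ (a b : Fin n) h, Fin.divNat (⟨a * n + b, h⟩ : Fin (n * n)) = a := fun a b h =>
    Fin.ext (by
      rw [Fin.coe_divNat]
      dsimp only
      rw [Nat.add_comm, Nat.add_mul_div_right _ _ b.pos, Nat.div_eq_of_lt b.2, Nat.zero_add])
  have mod : ∀ (a b : Fin n) h, Fin.modNat (⟨a * n + b, h⟩ : Fin (n * n)) = b := fun a b h =>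
    Fin.ext (by
      rw [Fin.coe_modNat]
      exact Nat.mul_add_mod_of_lt b.2)
  have hlt : (u : ℕ) * n + v < n * n := by
    have h := Nat.mul_le_mul_right n (Nat.succ_le_of_lt u.2)
    have := v.2
    rw [Nat.succ_mul] at h
    omega
  have e : (adjRows D).flatten = List.ofFn fun k : Fin (n * n) =>
      decide (D.Adj k.divNat k.modNat) := by
    rw [List.ofFn_mul]
    simp only [div, mod]
    rfl
  rw [e, List.getElem?_ofFn, dif_pos hlt]
  simp [div, mod]

theorem binVal_encodeNat (p : ℕ) : binVal (encodeNat p) = p := by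
  have pos : ∀ m : PosNum, binVal (encodePosNum m) = m := by
    intro m
    induction m with
    | one => rfl
    | bit0 m ih => simp [encodePosNum, binVal, ih, PosNum.cast_bit0]; omega
    | bit1 m ih => simp [encodePosNum, binVal, ih, PosNum.cast_bit1]; omega
  have num : ∀ m : Num, binVal (encodeNum m) = m := by
    rintro (_ | m)
    · rfl
    · exact pos m
  rw [encodeNat, num, Num.to_of_nat]

/-- The encoding has no leading zeros, so only 1 has a single digit. This lets the machine recognize
p = 1. -/
theorem encodeNat_eq_cons {b : Bool} {l : List Bool} {p : ℕ} (h : encodeNat p = b :: l) :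
    l = [] ↔ p = 1 := by
  have pos : ∀ m : PosNum, encodePosNum m ≠ [] := by rintro (_ | _ | _) <;> simp [encodePosNum]
  have num : ∀ m : Num, encodeNum m = b :: l → (l = [] ↔ (m : ℕ) = 1) := by
    rintro (_ | _ | m | m) h
    · cases h
    · cases h
      simp
    · cases h
      simp [pos, (PosNum.cast_pos (α := ℕ) m).ne']
    · cases h
      simp only [pos, false_iff, Num.cast_pos, PosNum.cast_bit0]
      omega
  rw [num _ h, Num.to_of_nat]

end StackProg

/-! ### The decision procedure -/

namespace StackProg

open Turing Function Computability

namespace Query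

/-- Starting from the set of all vertices, and replacing a set of vertices by the set of the heads of
the arcs with tail in it as many times as there are vertices, no vertex is left. -/
def acyclic : Query (Fin 4) :=
  .iter 3 0 (.bin (fun _ _ => true) (.arc 0 0) (.arc 0 0))
    (.fold or 1 (.bin and (.mem 3 1) (.arc 1 0)))
    (.bin (fun a _ => !a) (.fold or 0 (.mem 3 0)) (.arc 0 0))

/-- Evaluate `e` with the component of the vertex `0` in the complement as the set `3`. -/
def withComponent (e : Query (Fin 4)) : Query (Fin 4) :=
  .iter 3 1 (.bin (fun a b => !a && !b) (.lt 1 0) (.lt 0 1))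
    (.fold or 2 (.bin and (.mem 3 2) (.bin (fun a b => !a && !b) (.arc 2 1) (.arc 1 2)))) e

/-- The vertex `0` is the least vertex of the set `3`, and `e` holds. -/
def andLeast (e : Query (Fin 4)) : Query (Fin 4) :=
  .bin (fun a b => a && !b) e (.fold or 1 (.bin and (.mem 3 1) (.lt 1 0)))

/-- The parity of the set `3`, taken as a component of the complement. -/
def componentParity : Query (Fin 4) :=
  .fold xor 1 (.bin and (.mem 3 1) (.fold xor 2 (.bin or (.bin and (.mem 3 2) (.lt 1 2))
    (.bin (fun a b => a && !b) (.arc 1 2) (.mem 3 2)))))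

/-- The parity of the number of elements of the set `3`. -/
def cardParity : Query (Fin 4) := .fold xor 1 (.mem 3 1)

/-- Neither too many vertices at odd positions nor too many at even positions are required. -/
def balanced : Query (Fin 4) :=
  .bin and (.few 0 (withComponent (andLeast componentParity)))
    (.few 0 (withComponent (andLeast (.bin xor cardParity componentParity))))

theorem acyclic_scoped : acyclic.Scoped [] := by
  simp [acyclic, Scoped]

theorem balanced_scoped : balanced.Scoped [] := by
  simp [balanced, withComponent, andLeast, componentParity, cardParity, Scoped]

variable {n : ℕ} (D : OrientedGraph (Fin n))

/-- The operands `.arc 0 0` are dummies: the language has neither constants nor negation, so these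
are written as binary operations that ignore an argument. -/
theorem eval_acyclic (ρ : Fin 4 → ℕ) (V : Fin 4 → List Bool) :
    acyclic.eval n (adjRows D).flatten ρ V = true ↔ D.IsAcyclic := by
  obtain ⟨W, hW, h⟩ := eval_iter (n := n) (x := 3) (i := 0)
    (e₀ := .bin (fun _ _ => true) (.arc 0 0) (.arc 0 0))
    (e₁ := .fold or 1 (.bin and (.mem 3 1) (.arc 1 0)))
    (.bin (fun a _ => !a) (.fold or 0 (.mem 3 0)) (.arc 0 0)) (M := (adjRows D).flatten) (ρ := ρ)
    (V := V) (P₀ := fun _ => True) (F := D.outSet) (fun j => by simp [eval]) (fun W P hW j => by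
      rw [eval_fold_or]
      simp [eval, hW, getD_flatten_adjRows, OrientedGraph.outSet])
  rw [acyclic, h, D.isAcyclic_iff_iterate]
  change (!(fold or 0 (.mem 3 0)).eval n _ ρ (update V 3 W)) = true ↔ _
  rw [Bool.not_eq_true', ← Bool.not_eq_true, eval_fold_or]
  simp [eval, hW]

theorem eval_withComponent (e : Query (Fin 4)) {ρ : Fin 4 → ℕ} (V : Fin 4 → List Bool) {v : Fin n}
    (hv : ρ 0 = v) : ∃ W, (∀ u : Fin n, W[(u : ℕ)]?.getD false = true ↔ D.root u = D.root v) ∧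
      (withComponent e).eval n (adjRows D).flatten ρ V =
        e.eval n (adjRows D).flatten ρ (update V 3 W) := by
  obtain ⟨W, hW, h⟩ := eval_iter (n := n) (x := 3) (i := 1)
    (e₀ := .bin (fun a b => !a && !b) (.lt 1 0) (.lt 0 1))
    (e₁ := .fold or 2 (.bin and (.mem 3 2) (.bin (fun a b => !a && !b) (.arc 2 1) (.arc 1 2))))
    e (M := (adjRows D).flatten) (ρ := ρ) (V := V) (P₀ := fun u => u = v) (F := D.nonNeighbors)
    -- Equality of two indices is expressed by neither being smaller than the other.
    (fun j => by simp [eval, hv, Fin.ext_iff]; omega) (fun W P hW j => by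
      rw [eval_fold_or]
      simp [eval, hW, ← Bool.not_eq_true, getD_flatten_adjRows, OrientedGraph.nonNeighbors])
  refine ⟨W, fun u => ?_, h⟩
  rw [hW, D.iterate_nonNeighbors_iff]

variable {D} {ρ : Fin 4 → ℕ} {V : Fin 4 → List Bool} {v : Fin n}

theorem eval_andLeast (e : Query (Fin 4)) (hv : ρ 0 = v)
    (hV : ∀ u : Fin n, (V 3)[(u : ℕ)]?.getD false = true ↔ D.root u = D.root v) :
    (andLeast e).eval n (adjRows D).flatten ρ V = true ↔
      D.root v = v ∧ e.eval n (adjRows D).flatten ρ V = true := by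
  change (e.eval n _ ρ V && !(fold or 1 (.bin and (.mem 3 1) (.lt 1 0))).eval n _ ρ V) = true ↔ _
  rw [Bool.and_eq_true, and_comm, Bool.not_eq_true', ← Bool.not_eq_true, eval_fold_or,
    D.root_eq_self_iff]
  simp [eval, hV, hv]

theorem toZMod_eval_componentParity (hv : D.root v = v)
    (hV : ∀ u : Fin n, (V 3)[(u : ℕ)]?.getD false = true ↔ D.root u = D.root v) :
    toZMod (componentParity.eval n (adjRows D).flatten ρ V) = D.parity v := by
  classical
  rw [componentParity, toZMod_eval_fold_xor, OrientedGraph.parity, Finset.sum_filter]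
  refine Finset.sum_congr rfl fun u _ => ?_
  change toZMod (_ && (fold xor 2 _).eval n _ _ V) = _
  rw [toZMod_and, toZMod_eval_fold_xor]
  have hu : (mem 3 1).eval n (adjRows D).flatten (update ρ 1 u) V = true ↔ D.root u = v := by
    simp [eval, hV, hv]
  split_ifs with h
  · rw [toZMod_eq_one.mpr (hu.mpr h), one_mul]
    refine Finset.sum_congr rfl fun w _ => ?_
    have hw := hV w
    have hA := getD_flatten_adjRows D u w
    rw [hv, ← h] at hw
    simp only [eval, update_apply, toZMod, OrientedGraph.weight, Bool.or_eq_true, Bool.and_eq_true,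
      Bool.not_eq_true', ← Bool.not_eq_true, decide_eq_true_eq]
    by_cases hr : D.root w = D.root u
    · simp [hr, hw.mpr hr]
    · rw [if_neg hr]
      have := mt hw.mp hr
      refine if_congr ?_ rfl rfl
      tauto
  · rw [Bool.eq_false_of_not_eq_true (mt hu.mp h)]
    exact zero_mul _

theorem toZMod_eval_cardParity (hv : D.root v = v)
    (hV : ∀ u : Fin n, (V 3)[(u : ℕ)]?.getD false = true ↔ D.root u = D.root v) :
    toZMod (cardParity.eval n (adjRows D).flatten ρ V) =
      ((Finset.univ.filter fun u => D.root u = v).card : ZMod 2) := by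
  rw [cardParity, toZMod_eval_fold_xor, ← Finset.sum_boole]
  refine Finset.sum_congr rfl fun u _ => ?_
  simp [eval, toZMod, hV, hv]

theorem eval_balanced (ρ : Fin 4 → ℕ) (V : Fin 4 → List Bool) :
    balanced.eval n (adjRows D).flatten ρ V = true ↔
      2 * (Finset.univ.filter fun r => D.parity r = 1).card ≤ n + 1 ∧
      2 * (Finset.univ.filter fun r =>
        ((Finset.univ.filter fun u => D.root u = r).card : ZMod 2) + D.parity r = 1).card ≤
          n + 1 := by
  -- Components are counted through their least vertices. A vertex that is not a root satisfies no
  -- `andLeast` query and must not be counted on the other side either, whence the condition on `a`.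
  have key : ∀ (e : Query (Fin 4)) (a : Fin n → ZMod 2),
      (∀ (ρ : Fin 4 → ℕ) (V : Fin 4 → List Bool) (v : Fin n), D.root v = v →
        (∀ u : Fin n, (V 3)[(u : ℕ)]?.getD false = true ↔ D.root u = D.root v) →
        toZMod (e.eval n (adjRows D).flatten ρ V) = a v) →
      (∀ v, D.root v ≠ v → a v ≠ 1) →
      ((few 0 (withComponent (andLeast e))).eval n (adjRows D).flatten ρ V = true ↔
        2 * (Finset.univ.filter fun r => a r = 1).card ≤ n + 1) := by
    intro e a he ha
    rw [eval_few]
    have : ∀ v : Fin n, (withComponent (andLeast e)).eval n (adjRows D).flatten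
        (update ρ 0 v) V = true ↔ a v = 1 := by
      intro v
      have hv : update ρ 0 (v : ℕ) 0 = v := update_self ..
      obtain ⟨W, hW, h⟩ := eval_withComponent D (andLeast e) V hv
      have hW' : ∀ u : Fin n, (update V 3 W 3)[(u : ℕ)]?.getD false = true ↔
        D.root u = D.root v := by simpa using hW
      rw [h, eval_andLeast e hv hW']
      by_cases hr : D.root v = v
      · rw [← he _ _ v hr hW', toZMod_eq_one]
        exact and_iff_right hr
      · exact iff_of_false (fun h => hr h.1) (ha v hr)
    simp only [this]
  have hpar : ∀ v, D.root v ≠ v → D.parity v = 0 := by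
    intro v hv
    rw [OrientedGraph.parity, D.fiber_eq_empty hv, Finset.sum_empty]
  change (_ && _) = true ↔ _
  rw [Bool.and_eq_true]
  refine and_congr (key _ _ (fun ρ V v hv hV => toZMod_eval_componentParity hv hV)
    fun v hv => ?_) (key _ _ (fun ρ V v hv hV => ?_) fun v hv => ?_)
  · rw [hpar v hv]
    decide
  · rw [← toZMod_eval_componentParity hv hV (ρ := ρ), ← toZMod_eval_cardParity hv hV (ρ := ρ),
      ← toZMod_xor]
    rfl
  · rw [hpar v hv, D.fiber_eq_empty hv, Finset.card_empty]
    decide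

end Query

theorem encode_eq_inputString (I : EqInversionInstance) :
    I.encode = inputString (encodeNat I.p) (adjRows I.graph) := by
  simp only [EqInversionInstance.encode, inputString, adjRows, EqInversionInstance.encodeRow,
    List.ofFn_eq_map, List.flatMap_map, List.map_map]
  rfl

theorem length_adjRows {n : ℕ} (D : OrientedGraph (Fin n)) : (adjRows D).length = n :=
  List.length_ofFn

theorem decideBy_answer (I : EqInversionInstance) {b : Bool} {l : List Bool}
    (h : encodeNat I.p = b :: l) :
    (if decide (I.n ≤ I.p) || l.isEmpty then
      Query.acyclic.eval I.n (adjRows I.graph).flatten (fun _ => 0) (fun _ => [])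
      else !b || Query.balanced.eval I.n (adjRows I.graph).flatten (fun _ => 0) (fun _ => [])) =
        I.answer := by
  classical
  have hp := binVal_encodeNat I.p
  rw [h, binVal] at hp
  have hl := encodeNat_eq_cons h
  rw [EqInversionInstance.answer, Bool.eq_iff_iff, decide_eq_true_iff]
  have hne := I.order_ne
  have hpos := I.p_pos
  split_ifs with hc
  · rw [Query.eval_acyclic, OrientedGraph.isEqInvertible_iff_isAcyclic]
    simpa [hl, or_comm] using hc
  · simp only [Bool.or_eq_true, decide_eq_true_eq, List.isEmpty_iff, hl, not_or] at hc
    -- The order exceeds p here, and it differs from p + 1 by assumption.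
    have hV : I.p + 2 ≤ Fintype.card (Fin I.n) := by
      rw [Fintype.card_fin]
      omega
    cases b
    · refine iff_of_true rfl (I.graph.isEqInvertible_of_even (by omega) ?_ hV)
      rw [Nat.even_iff]
      simp at hp
      omega
    · have hodd : Odd I.p := by
        rw [Nat.odd_iff]
        simp at hp
        omega
      rw [I.graph.isEqInvertible_iff_card (by rw [Nat.odd_iff] at hodd; omega) hodd hV,
        Fintype.card_fin, ← Query.eval_balanced (fun _ => 0) (fun _ => [])]
      simp

end StackProg

theorem theorem3 :
    ∃ M : Turing.TM2ComputableInPolyTime EqInversionInstance.encode Computability.encodeBool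
        EqInversionInstance.answer,
      ∀ k, Finite (M.tm.Γ k) := by
  refine StackProg.exists_machine (StackProg.decideBy .acyclic .balanced) .inp .res
    (fun a => StackProg.isOne (some a)) EqInversionInstance.encode EqInversionInstance.answer
    (.X * (.C 3 * .X + .C 25) + .C 30 + StackProg.Query.acyclic.cost +
      StackProg.Query.balanced.cost) fun I => ?_
  -- As p is positive, its encoding has a first digit for `inspect` to read.
  obtain ⟨b, l, h⟩ : ∃ b l, Computability.encodeNat I.p = b :: l := by
    rcases h : Computability.encodeNat I.p with _ | ⟨b, l⟩
    · have := StackProg.binVal_encodeNat I.p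
      rw [h] at this
      exact absurd this.symm I.p_pos.ne'
    · exact ⟨b, l, rfl⟩
  obtain ⟨t, ht, hrun⟩ := StackProg.runsIn_decideBy _ _ StackProg.Query.acyclic_scoped
    StackProg.Query.balanced_scoped b l (StackProg.adjRows I.graph)
  have hb := StackProg.binVal_encodeNat I.p
  rw [h] at hb
  rw [StackProg.length_adjRows, hb, StackProg.decideBy_answer I h] at hrun
  rw [StackProg.encode_eq_inputString, h]
  exact ⟨t, ht, _, by simp, hrun⟩
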